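/- Let $\mathbf R_+=[0,\infty)$, $a>0$, $p,q>0$, $h(x)=e^{-p|x|^2}$, $m(v)=e^{-q|v|^2}$. Consider on $\mathbf R_+\times\mathbf R^3\times\mathbf R^3$ the Enskog equation $$\partial_t f+v\cdot\partial_x f+E(t,x)\cdot\partial_v f=Q(f)=Q^+(f)-Q^-(f),$$ $$Q^+(f)(t,x,v)=\int F^+(f)\,f(t,x,v')\,f(t,x-a\omega,w')\,(v-w)\cdot\omega\;d\omega\,dw,$$ $$Q^-(f)(t,x,v)=\int F^-(f)\,f(t,x,v)\,f(t,x+a\omega,w)\,(v-w)\cdot\omega\;d\omega\,dw,$$ both integrals being over the $(w,\omega)\in\mathbf R^3\times S^2$ with $\omega\cdot(v-w)\ge 0$, where $v'=v-[(v-w)\cdot\omega]\omega$ and $w'=w+[(v-w)\cdot\omega]\omega$. **The force.** Let $E:\mathbf R_+\times\mathbf R^3\to\mathbf R^3$ be such that for every $(t,x,v)\in\mathbf R_+\times\mathbf R^3\times\mathbf R^3$ the system $\frac{dX}{ds}=V$, $\frac{dV}{ds}=E(s,X)$, $(X,V)|_{s=t}=(x,v)$ has a solution $[X(s;t,x,v),V(s;t,x,v)]$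 on $\mathbf R_+$, and suppose there are real functions $\alpha_i(s;t,x,v)$ ($i=1,2,3$), with $\alpha_1,\alpha_2$ differentiable in $s$, and constants $\alpha_0,\tau_0>0$ such that, for all $s\in\mathbf R_+$, $(t,x,v)\in\mathbf R_+\times\mathbf R^3\times\mathbf R^3$ and $\xi,\eta\in\mathbf R^3$ (the $\alpha_i$ being taken at $(s;t,x,v)$ and $'$ denoting $d/ds$): 1. $\alpha_1>0$ if $s>0$, $\alpha_1(0;t,x,v)\ge0$, $\alpha_2>0$, $\alpha_3\ge0$; 2. $X(0;s,X(s;t,x,v)+\xi,V(s;t,x,v)-\eta)=X(0;t,x,v)+\alpha_1\eta+\alpha_2\xi$; 3. $V(0;s,X(s;t,x,v)+\xi,V(s;t,x,v)-\eta)=V(0;t,x,v)-\alpha_2\eta-\alpha_3\xi$; 4. for each $(t,x,v)$, either $\alpha_3(s;t,x,v)=0$ for all $s$, or $\max\{\alpha_1,\alpha_3\}/\alpha_2\le\tau_0$ for all $s$; 5. $\min\{\alpha_2^2\alpha,\ \alpha_2\alpha,\ \alpha_2\}\ge\alpha_0$, where $\alpha=\alpha_1'\alpha_2-\alpha_1\alpha_2'$.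 **The norm.** For $f\in C(\mathbf R_+\times\mathbf R^3\times\mathbf R^3)$ put $\|f\|=\sup_{t,x,v}|f(t,x,v)|\,h^{-1}(X(0;t,x,v))\,m^{-1}(V(0;t,x,v))\in[0,\infty]$ and $M_R=\{f\in C(\mathbf R_+\times\mathbf R^3\times\mathbf R^3):\|f\|\le R\}$. **The collision factors.** $F^\pm$ are functionals on $\bigcup_R M_R$ with real values, or more generally with values $F^\pm(f)=F^\pm(f)(t,x,\omega)$ in the continuous functions on $\mathbf R_+\times\mathbf R^3\times S^2$, such that $F^\pm(0)$ is bounded, and for a positive nondecreasing function $L$ on $\mathbf R_+$ $$|F^\pm(f)-F^\pm(g)|\le L(R)\,\|f-g\|\qquad\text{for all }R\ge0,\ f,g\in M_R$$ (at every $(t,x,\omega)$). Moreover $F^+(f)\ge0$ whenever $f\ge0$. **Mild solutions.** A global mild solution with continuous initial datum $f_0$ is an $f\in C(\mathbf R_+\times\mathbf R^3\times\mathbf R^3)$ with $f(0,x,v)=f_0(x,v)$ such that for almost every $(t,x,v)$ $$f(t,x,v)=f_0(X(0;t,x,v),V(0;t,x,v))+\int_0^tQ(f)(s,X(s;t,x,v),V(s;t,x,v))\,ds,$$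 the collision integrals (for almost every $s\in(0,t)$) and the integral over $s$ being absolutely convergent. **Theorem.** There are $R_0>0$ and $\delta>0$ such that for every continuous $f_0:\mathbf R^3\times\mathbf R^3\to[0,\infty)$ with $$\sup_{t,x,v} f_0(X(0;t,x,v),V(0;t,x,v))\,h^{-1}(X(0;t,x,v))\,m^{-1}(V(0;t,x,v))\le\delta$$ the Enskog equation has a global mild solution $f\in M_{R_0}$ with initial datum $f_0$ and $f\ge0$, and $f$ is the only global mild solution in $M_{R_0}$ with initial datum $f_0$. -/

import Mathlib

open MeasureTheory Set
open scoped NNReal ENNReal RealInnerProductSpace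

noncomputable section

namespace Enskog

/-- Three-dimensional Euclidean space, used both for positions and for velocities. -/
abbrev E3 : Type := EuclideanSpace ℝ (Fin 3)

/-- The unit sphere of `E3`. -/
abbrev S2 : Type := Metric.sphere (0 : E3) 1

/-- Surface measure on the unit sphere (total mass `4π`). -/
def surf : Measure S2 := (volume : Measure E3).toSphere

/-- The space `ℝ₊ × ℝ³ × ℝ³` of triples `(t, x, v)`. -/
abbrev Phase : Type := ℝ≥0 × E3 × E3

/-- Families of curves, `Z s t x v` standing for `Z(s; t, x, v)`, with `s, t ∈ ℝ₊`. -/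
abbrev Curves : Type := ℝ≥0 → ℝ≥0 → E3 → E3 → E3

/-- Scalar coefficients, `α s t x v` standing for `α(s; t, x, v)`. -/
abbrev Coeff : Type := ℝ≥0 → ℝ≥0 → E3 → E3 → ℝ

/-- `s ↦ (X(s;t,x,v), V(s;t,x,v))` solves the bicharacteristic equations
`dX/ds = V`, `dV/ds = E(s, X)`, `(X, V)|_{s=t} = (x, v)` on all of `ℝ₊`
(the derivative at `s = 0` is one-sided). -/
structure IsBicharacteristic (E : ℝ≥0 → E3 → E3) (X V : Curves) : Prop where
  init_X : ∀ t x v, X t t x v = x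
  init_V : ∀ t x v, V t t x v = v
  deriv_X : ∀ (s t : ℝ≥0) (x v : E3),
    HasDerivWithinAt (fun r : ℝ => X r.toNNReal t x v) (V s t x v) (Ici 0) (s : ℝ)
  deriv_V : ∀ (s t : ℝ≥0) (x v : E3),
    HasDerivWithinAt (fun r : ℝ => V r.toNNReal t x v) (E s (X s t x v)) (Ici 0) (s : ℝ)

/-- The derivative of a coefficient in `s` (one-sided at `s = 0`). -/
def dCoeff (α : Coeff) : Coeff := fun s t x v =>
  derivWithin (fun r : ℝ => α r.toNNReal t x v) (Ici 0) (s : ℝ)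

/-- `α = α₁' α₂ - α₁ α₂'`. -/
def wronskian (α₁ α₂ : Coeff) : Coeff := fun s t x v =>
  dCoeff α₁ s t x v * α₂ s t x v - α₁ s t x v * dCoeff α₂ s t x v

/-- The five structural conditions on the bicharacteristic curves. -/
structure ForceConditions (X V : Curves) (α₁ α₂ α₃ : Coeff) (α₀ τ₀ : ℝ) : Prop where
  α₀_pos : 0 < α₀
  τ₀_pos : 0 < τ₀
  diff₁ : ∀ t x v, DifferentiableOn ℝ (fun r : ℝ => α₁ r.toNNReal t x v) (Ici 0)
  diff₂ : ∀ t x v, DifferentiableOn ℝ (fun r : ℝ => α₂ r.toNNReal t x v) (Ici 0)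
  α₁_pos : ∀ s t x v, 0 < s → 0 < α₁ s t x v
  α₁_zero : ∀ t x v, 0 ≤ α₁ 0 t x v
  α₂_pos : ∀ s t x v, 0 < α₂ s t x v
  α₃_nonneg : ∀ s t x v, 0 ≤ α₃ s t x v
  shift_X : ∀ (s t : ℝ≥0) (x v ξ η : E3),
    X 0 s (X s t x v + ξ) (V s t x v - η)
      = X 0 t x v + α₁ s t x v • η + α₂ s t x v • ξ
  shift_V : ∀ (s t : ℝ≥0) (x v ξ η : E3),
    V 0 s (X s t x v + ξ) (V s t x v - η)
      = V 0 t x v - α₂ s t x v • η - α₃ s t x v • ξ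
  ratio : ∀ t x v, (∀ s, α₃ s t x v = 0) ∨
    (∀ s, max (α₁ s t x v) (α₃ s t x v) / α₂ s t x v ≤ τ₀)
  lower : ∀ s t x v,
    α₀ ≤ min (min (α₂ s t x v ^ 2 * wronskian α₁ α₂ s t x v)
      (α₂ s t x v * wronskian α₁ α₂ s t x v)) (α₂ s t x v)

/-- The Gaussian weight `z ↦ exp (-c |z|²)`; `h` is `gauss p` and `m` is `gauss q`. -/
def gauss (c : ℝ) (z : E3) : ℝ := Real.exp (-c * ‖z‖ ^ 2)

/-- The weighted supremum norm
`sup_{t,x,v} |g(t,x,v)| h⁻¹(X(0;t,x,v)) m⁻¹(V(0;t,x,v))`, with values in `[0, ∞]`. -/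
def wnorm (p q : ℝ) (X V : Curves) (g : Phase → ℝ) : ℝ≥0∞ :=
  ⨆ z : Phase, ENNReal.ofReal
    (|g z| * (gauss p (X 0 z.1 z.2.1 z.2.2))⁻¹ * (gauss q (V 0 z.1 z.2.1 z.2.2))⁻¹)

/-- The ball `M_R` of continuous functions whose weighted norm is at most `R`. -/
def ball (p q : ℝ) (X V : Curves) (R : ℝ≥0) : Set C(Phase, ℝ) :=
  {f | wnorm p q X V f ≤ R}

/-- A collision factor: a functional of `f` whose value may moreover depend continuously on
the time `t`, the position `x` and the direction `ω` (a real-valued functional is the case in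
which `F f` is a constant function). Only its values at `f` of finite weighted norm matter. -/
abbrev Factor : Type := C(Phase, ℝ) → C(ℝ≥0 × E3 × S2, ℝ)

/-- `|F(f) - F(g)| ≤ L(R) ‖f - g‖` for all `f, g ∈ M_R` and all `R`, with `F(0)` finite. -/
structure IsLocallyLipschitz (p q : ℝ) (X V : Curves) (L : ℝ≥0 → ℝ≥0) (F : Factor) : Prop where
  bounded_zero : ∃ C : ℝ, ∀ y, |F 0 y| ≤ C
  lipschitz : ∀ R : ℝ≥0, ∀ f ∈ ball p q X V R, ∀ g ∈ ball p q X V R, ∀ y,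
    ENNReal.ofReal |F f y - F g y| ≤ L R * wnorm p q X V (fun z => f z - g z)

/-- `B(u, ω) = u · ω`. -/
def kernelB (u : E3) (ω : S2) : ℝ := ⟪u, (ω : E3)⟫

/-- `v' = v - [(v - w) · ω] ω`. -/
def velV (v w : E3) (ω : S2) : E3 := v - kernelB (v - w) ω • (ω : E3)

/-- `w' = w + [(v - w) · ω] ω`. -/
def velW (v w : E3) (ω : S2) : E3 := w + kernelB (v - w) ω • (ω : E3)

/-- The domain of integration `{(w, ω) : w ∈ ℝ³, ω ∈ S², ω · (v - w) ≥ 0}`. -/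
def collisionDomain (v : E3) : Set (E3 × S2) := {y | 0 ≤ kernelB (v - y.1) y.2}

/-- The integrand of `Q⁺(f)(t,x,v)`, as a function of `(w, ω)`. -/
def gainIntegrand (a : ℝ) (Fp : Factor) (f : C(Phase, ℝ)) (t : ℝ≥0) (x v : E3)
    (y : E3 × S2) : ℝ :=
  Fp f (t, x, y.2) * f (t, x, velV v y.1 y.2)
    * f (t, x - a • (y.2 : E3), velW v y.1 y.2) * kernelB (v - y.1) y.2

/-- The integrand of `Q⁻(f)(t,x,v)`, as a function of `(w, ω)`. -/
def lossIntegrand (a : ℝ) (Fm : Factor) (f : C(Phase, ℝ)) (t : ℝ≥0) (x v : E3)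
    (y : E3 × S2) : ℝ :=
  Fm f (t, x, y.2) * f (t, x, v) * f (t, x + a • (y.2 : E3), y.1) * kernelB (v - y.1) y.2

/-- The Enskog collision operator `Q(f) = Q⁺(f) - Q⁻(f)`. -/
def collision (a : ℝ) (Fp Fm : Factor) (f : C(Phase, ℝ)) (t : ℝ≥0) (x v : E3) : ℝ :=
  (∫ y in collisionDomain v, gainIntegrand a Fp f t x v y ∂((volume : Measure E3).prod surf))
    - ∫ y in collisionDomain v, lossIntegrand a Fm f t x v y ∂((volume : Measure E3).prod surf)

/-- The collision integrals `Q⁺(f)(t,x,v)` and `Q⁻(f)(t,x,v)` converge absolutely. -/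
def CollisionConverges (a : ℝ) (Fp Fm : Factor) (f : C(Phase, ℝ)) (t : ℝ≥0) (x v : E3) : Prop :=
  IntegrableOn (gainIntegrand a Fp f t x v) (collisionDomain v)
      ((volume : Measure E3).prod surf) ∧
    IntegrableOn (lossIntegrand a Fm f t x v) (collisionDomain v)
      ((volume : Measure E3).prod surf)

/-- The integral equation at the point `(t,x,v)`: the integrals in it converge absolutely and
`f(t,x,v) = f₀(X(0;t,x,v), V(0;t,x,v)) + ∫₀ᵗ Q(f)(s, X(s;t,x,v), V(s;t,x,v)) ds`. -/
structure MildAt (a : ℝ) (X V : Curves) (Fp Fm : Factor) (f₀ : C(E3 × E3, ℝ))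
    (f : C(Phase, ℝ)) (t : ℝ≥0) (x v : E3) : Prop where
  converges : ∀ᵐ s : ℝ, s ∈ Ioc 0 (t : ℝ) →
    CollisionConverges a Fp Fm f s.toNNReal (X s.toNNReal t x v) (V s.toNNReal t x v)
  integrable : IntervalIntegrable
    (fun s : ℝ => collision a Fp Fm f s.toNNReal (X s.toNNReal t x v) (V s.toNNReal t x v))
    volume 0 (t : ℝ)
  equation : f (t, x, v) = f₀ (X 0 t x v, V 0 t x v)
    + ∫ s in (0 : ℝ)..(t : ℝ),
        collision a Fp Fm f s.toNNReal (X s.toNNReal t x v) (V s.toNNReal t x v)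

/-- `f` is a global mild solution with initial datum `f₀`: `f(0,x,v) = f₀(x,v)` for all `x, v`,
and the integral equation holds for almost every `(t,x,v) ∈ ℝ₊ × ℝ³ × ℝ³`. -/
structure IsMildSolution (a : ℝ) (X V : Curves) (Fp Fm : Factor) (f₀ : C(E3 × E3, ℝ))
    (f : C(Phase, ℝ)) : Prop where
  initial : ∀ x v, f (0, x, v) = f₀ (x, v)
  mild : ∀ᵐ z : ℝ × E3 × E3, 0 ≤ z.1 → MildAt a X V Fp Fm f₀ f z.1.toNNReal z.2.1 z.2.2

end Enskog

end

/-! The force enters only through the geometry of the flow. At `s = t` the shift conditions say that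
the backward map to time `0` is affine with scalar coefficients, `X₀ = b + a₂x - a₁v` and `V₀ = c +
a₂v - a₃x`, where `aᵢ(s) = αᵢ(s;s,0,0)`. Comparing trajectories issued at time `0` shows that the
Wronskian of the linear part is constant, so `a₂² - a₁a₃ = 1`, and moreover `a₁' = a₂`, `a₂' = a₃`.
Hence `τ = a₁/a₂` is an increasing clock with `dτ = ds/a₂²` (`ForceConditions.det_eq_one`,
`AffineFlow.hasDerivAt_ratio`).

Two facts make the weighted sup norm work. The transported weight is constant along trajectories,
and the product of the weights of two particles does not increase when post-collisional velocities
are replaced by pre-collisional ones: the backward images move by opposite multiples of `ω`, and the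
displacement `aω` gives the cross terms a favourable sign (`AffineFlow.wt_velV_mul_wt_velW_le`). So
gain and loss are both bounded by the weight times a collision frequency. That frequency has a
bounded time integral along every trajectory: after a change of velocity variable the particle
partner moves on a straight line in the clock `τ`, and a Gaussian integrated along a line at speed
`‖y‖`, with the factor `‖y‖` coming from the kernel, is bounded uniformly in the line
(`AffineFlow.lintegral_line_le`, `AffineFlow.lintegral_direction_le`).

The integrated collision operator is thus Lipschitz on the ball of radius `R` with constant `K * R`,
a contraction for small `R` (`AffineFlow.exists_abs_collInt_sub_le`). To obtain positivity the
contraction principle is applied to a modified equation in which the gain, the collision partners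
and both collision factors are evaluated at `|f|`. Along a trajectory this is a scalar linear
equation for `f` with nonnegative source, so `f ≥ 0`, `|f| = f`, and the original equation holds. -/

noncomputable section

namespace Enskog

/-- A flow on phase space whose backward maps to time `0` are affine, with scalar coefficients
depending on time only and determinant `1`. -/
structure AffineFlow (X V : Curves) (a₁ a₂ a₃ : ℝ≥0 → ℝ) (b c : ℝ≥0 → E3) : Prop where
  cont₁ : Continuous a₁
  cont₂ : Continuous a₂
  cont₃ : Continuous a₃
  cont_b : Continuous b
  cont_c : Continuous c
  det : ∀ s, a₂ s ^ 2 - a₁ s * a₃ s = 1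
  back_X : ∀ t x v, X 0 t x v = b t + a₂ t • x - a₁ t • v
  back_V : ∀ t x v, V 0 t x v = c t + a₂ t • v - a₃ t • x
  invariant_X : ∀ s t x v, X 0 s (X s t x v) (V s t x v) = X 0 t x v
  invariant_V : ∀ s t x v, V 0 s (X s t x v) (V s t x v) = V 0 t x v
  init_X : ∀ t x v, X t t x v = x
  init_V : ∀ t x v, V t t x v = v
  deriv₁ : ∀ s : ℝ≥0, HasDerivWithinAt (fun r : ℝ => a₁ r.toNNReal) (a₂ s) (Ici 0) s
  deriv₂ : ∀ s : ℝ≥0, HasDerivWithinAt (fun r : ℝ => a₂ r.toNNReal) (a₃ s) (Ici 0) s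

/-! ### The affine structure of the flow forced by the shift conditions -/

section Derivation

variable {E : ℝ≥0 → E3 → E3} {X V : Curves} {α₁ α₂ α₃ : Coeff} {α₀ τ₀ : ℝ}

theorem ForceConditions.back_X (hf : ForceConditions X V α₁ α₂ α₃ α₀ τ₀)
    (hXV : IsBicharacteristic E X V) (t : ℝ≥0) (x v : E3) :
    X 0 t x v = X 0 t 0 0 + α₂ t t 0 0 • x - α₁ t t 0 0 • v := by
  have h := hf.shift_X t t 0 0 x (-v)
  rw [hXV.init_X, hXV.init_V] at h
  simp only [zero_add, sub_neg_eq_add, smul_neg] at h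
  rw [h]; abel

theorem ForceConditions.back_V (hf : ForceConditions X V α₁ α₂ α₃ α₀ τ₀)
    (hXV : IsBicharacteristic E X V) (t : ℝ≥0) (x v : E3) :
    V 0 t x v = V 0 t 0 0 + α₂ t t 0 0 • v - α₃ t t 0 0 • x := by
  have h := hf.shift_V t t 0 0 x (-v)
  rw [hXV.init_X, hXV.init_V] at h
  simp only [zero_add, sub_neg_eq_add, smul_neg] at h
  rw [h]

theorem ForceConditions.invariant_X (hf : ForceConditions X V α₁ α₂ α₃ α₀ τ₀)
    (s t : ℝ≥0) (x v : E3) : X 0 s (X s t x v) (V s t x v) = X 0 t x v := by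
  simpa using hf.shift_X s t x v 0 0

theorem ForceConditions.invariant_V (hf : ForceConditions X V α₁ α₂ α₃ α₀ τ₀)
    (s t : ℝ≥0) (x v : E3) : V 0 s (X s t x v) (V s t x v) = V 0 t x v := by
  simpa using hf.shift_V s t x v 0 0

/-- Differences of trajectories issued at time `0` solve the linear system given by the
backward maps. -/
theorem ForceConditions.trajectory_sub (hf : ForceConditions X V α₁ α₂ α₃ α₀ τ₀)
    (hXV : IsBicharacteristic E X V) (s : ℝ≥0) (x v : E3) :
    α₂ s s 0 0 • (X s 0 x v - X s 0 0 0) - α₁ s s 0 0 • (V s 0 x v - V s 0 0 0) = x ∧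
    α₂ s s 0 0 • (V s 0 x v - V s 0 0 0) - α₃ s s 0 0 • (X s 0 x v - X s 0 0 0) = v := by
  have h1 := hf.invariant_X s 0 x v
  have h2 := hf.invariant_X s 0 0 0
  have h3 := hf.invariant_V s 0 x v
  have h4 := hf.invariant_V s 0 0 0
  rw [hf.back_X hXV s, hXV.init_X] at h1 h2
  rw [hf.back_V hXV s, hXV.init_V] at h3 h4
  constructor
  · linear_combination (norm := module) h1 - h2
  · linear_combination (norm := module) h3 - h4

theorem ForceConditions.det_smul (hf : ForceConditions X V α₁ α₂ α₃ α₀ τ₀)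
    (hXV : IsBicharacteristic E X V) (s : ℝ≥0) (x v : E3) :
    (α₂ s s 0 0 ^ 2 - α₁ s s 0 0 * α₃ s s 0 0) • (X s 0 x v - X s 0 0 0)
        = α₂ s s 0 0 • x + α₁ s s 0 0 • v ∧
    (α₂ s s 0 0 ^ 2 - α₁ s s 0 0 * α₃ s s 0 0) • (V s 0 x v - V s 0 0 0)
        = α₃ s s 0 0 • x + α₂ s s 0 0 • v := by
  obtain ⟨h1, h2⟩ := hf.trajectory_sub hXV s x v
  generalize X s 0 x v - X s 0 0 0 = P at *
  generalize V s 0 x v - V s 0 0 0 = U at *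
  subst h1 h2
  constructor <;> module

theorem exists_unit_E3 : ∃ e : E3, ⟪e, e⟫ = 1 := by
  refine ⟨EuclideanSpace.single 0 1, ?_⟩
  rw [real_inner_self_eq_norm_sq]; simp

/-- A vanishing determinant would give `α₂ • e = 0` for the trajectory issued from `(e, 0)`, against
`α₂ > 0`. -/
theorem ForceConditions.det_ne_zero (hf : ForceConditions X V α₁ α₂ α₃ α₀ τ₀)
    (hXV : IsBicharacteristic E X V) (s : ℝ≥0) :
    α₂ s s 0 0 ^ 2 - α₁ s s 0 0 * α₃ s s 0 0 ≠ 0 := by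
  intro h
  obtain ⟨e, he⟩ := exists_unit_E3
  have h1 := (hf.det_smul hXV s e 0).1
  rw [h, zero_smul, smul_zero, add_zero] at h1
  have h2 := smul_eq_zero.1 h1.symm
  rcases h2 with h2 | h2
  · exact (hf.α₂_pos s s 0 0).ne' h2
  · simp [h2] at he

/-- The component along `e` of the difference of two trajectories issued at time `0`. -/
theorem ForceConditions.inner_trajectory (hf : ForceConditions X V α₁ α₂ α₃ α₀ τ₀)
    (hXV : IsBicharacteristic E X V) {e : E3} (he : ⟪e, e⟫ = 1) (s : ℝ≥0) (k l : ℝ) :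
    ⟪e, X s 0 (k • e) (l • e) - X s 0 0 0⟫
        = (α₂ s s 0 0 * k + α₁ s s 0 0 * l) / (α₂ s s 0 0 ^ 2 - α₁ s s 0 0 * α₃ s s 0 0) ∧
    ⟪e, V s 0 (k • e) (l • e) - V s 0 0 0⟫
        = (α₃ s s 0 0 * k + α₂ s s 0 0 * l) / (α₂ s s 0 0 ^ 2 - α₁ s s 0 0 * α₃ s s 0 0) := by
  have hD := hf.det_ne_zero hXV s
  obtain ⟨h1, h2⟩ := hf.det_smul hXV s (k • e) (l • e)
  constructor
  · rw [eq_div_iff hD, mul_comm, ← real_inner_smul_right, h1]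
    simp only [inner_add_right, real_inner_smul_right, he]; ring
  · rw [eq_div_iff hD, mul_comm, ← real_inner_smul_right, h2]
    simp only [inner_add_right, real_inner_smul_right, he]; ring

theorem IsBicharacteristic.deriv_inner (hXV : IsBicharacteristic E X V) (e x v : E3) (s : ℝ≥0) :
    HasDerivWithinAt (fun r : ℝ => ⟪e, X r.toNNReal 0 x v - X r.toNNReal 0 0 0⟫)
      ⟪e, V s 0 x v - V s 0 0 0⟫ (Ici 0) s ∧
    HasDerivWithinAt (fun r : ℝ => ⟪e, V r.toNNReal 0 x v - V r.toNNReal 0 0 0⟫)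
      ⟪e, E s (X s 0 x v) - E s (X s 0 0 0)⟫ (Ici 0) s := by
  constructor
  · simpa using (hasDerivWithinAt_const (s : ℝ) (Ici 0) e).inner ℝ
      ((hXV.deriv_X s 0 x v).sub (hXV.deriv_X s 0 0 0))
  · simpa using (hasDerivWithinAt_const (s : ℝ) (Ici 0) e).inner ℝ
      ((hXV.deriv_V s 0 x v).sub (hXV.deriv_V s 0 0 0))

/-- Along a fixed unit vector `e`, the trajectories with data `(e, 0)` and `(0, e)`, taken relative
to the one issued from the origin, form a 2×2 fundamental matrix. Its Wronskian is the inverse of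
the determinant in question, equals `1` at time `0`, and is constant although `E` is not assumed
differentiable or linear. -/
theorem ForceConditions.det_eq_one (hf : ForceConditions X V α₁ α₂ α₃ α₀ τ₀)
    (hXV : IsBicharacteristic E X V) (s : ℝ≥0) :
    α₂ s s 0 0 ^ 2 - α₁ s s 0 0 * α₃ s s 0 0 = 1 := by
  obtain ⟨e, he⟩ := exists_unit_E3
  let p₁ : ℝ → ℝ := fun r => ⟪e, X r.toNNReal 0 ((1 : ℝ) • e) ((0 : ℝ) • e) - X r.toNNReal 0 0 0⟫
  let p₂ : ℝ → ℝ := fun r => ⟪e, X r.toNNReal 0 ((0 : ℝ) • e) ((1 : ℝ) • e) - X r.toNNReal 0 0 0⟫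
  let q₁ : ℝ → ℝ := fun r => ⟪e, V r.toNNReal 0 ((1 : ℝ) • e) ((0 : ℝ) • e) - V r.toNNReal 0 0 0⟫
  let q₂ : ℝ → ℝ := fun r => ⟪e, V r.toNNReal 0 ((0 : ℝ) • e) ((1 : ℝ) • e) - V r.toNNReal 0 0 0⟫
  have hconst : ∀ r : ℝ≥0, HasDerivWithinAt (fun r => p₁ r * q₂ r - p₂ r * q₁ r) 0 (Ici 0) r := by
    intro r
    obtain ⟨d1, d2⟩ := hXV.deriv_inner e ((1 : ℝ) • e) ((0 : ℝ) • e) r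
    obtain ⟨d3, d4⟩ := hXV.deriv_inner e ((0 : ℝ) • e) ((1 : ℝ) • e) r
    set k₁ := ⟪e, E r (X r 0 ((1 : ℝ) • e) ((0 : ℝ) • e)) - E r (X r 0 0 0)⟫
    set k₂ := ⟪e, E r (X r 0 ((0 : ℝ) • e) ((1 : ℝ) • e)) - E r (X r 0 0 0)⟫
    -- The data `(p₂ r • e, -p₁ r • e)` are chosen so that this trajectory meets the reference one
    -- at time `r`. The two then feel the same force, so the relative velocity has zero derivative
    -- there; by linearity in the data that derivative is also `k₁ p₂ - k₂ p₁`.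
    have key : k₁ * p₂ r - k₂ * p₁ r = 0 := by
      obtain ⟨-, d5⟩ := hXV.deriv_inner e (p₂ r • e) ((-p₁ r) • e) r
      have hX : X r 0 (p₂ r • e) ((-p₁ r) • e) = X r 0 0 0 := by
        have h := (hf.det_smul hXV r (p₂ r • e) ((-p₁ r) • e)).1
        have h0 : α₂ r r 0 0 • p₂ r • e + α₁ r r 0 0 • (-p₁ r) • e = 0 := by
          simp only [p₁, p₂, Real.toNNReal_coe, (hf.inner_trajectory hXV he r _ _).1]
          module
        rw [h0] at h
        exact sub_eq_zero.1 ((smul_eq_zero.1 h).resolve_left (hf.det_ne_zero hXV r))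
      rw [hX, sub_self, inner_zero_right] at d5
      have d6 := (d2.mul_const (p₂ r)).sub (d4.mul_const (p₁ r))
      refine (uniqueDiffOn_Ici (0 : ℝ) (r : ℝ) r.2).eq_deriv _ d6 (d5.congr_of_mem ?_ r.2)
      intro y _
      simp only [Pi.sub_apply, (hf.inner_trajectory hXV he _ _ _).2]
      ring
    refine ((d1.mul d4).sub (d3.mul d2)).congr_deriv ?_
    simp only [p₁, p₂, Real.toNNReal_coe] at key ⊢
    linear_combination -key
  have hW : ∀ r : ℝ≥0, p₁ r * q₂ r - p₂ r * q₁ r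
      = (α₂ r r 0 0 ^ 2 - α₁ r r 0 0 * α₃ r r 0 0)⁻¹ := by
    intro r
    have hD := hf.det_ne_zero hXV r
    simp only [p₁, p₂, q₁, q₂, Real.toNNReal_coe, hf.inner_trajectory hXV he]
    field_simp
    ring
  have h0 : p₁ 0 * q₂ 0 - p₂ 0 * q₁ 0 = 1 := by
    simp only [p₁, p₂, q₁, q₂, Real.toNNReal_zero, hXV.init_X, hXV.init_V, one_smul, zero_smul,
      sub_zero, he, inner_zero_right, mul_one, mul_zero]
  have h1 := constant_of_has_deriv_right_zero (f := fun r => p₁ r * q₂ r - p₂ r * q₁ r)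
    (a := 0) (b := s)
    (fun r hr => ((hconst ⟨r, hr.1⟩).continuousWithinAt).mono Icc_subset_Ici_self)
    (fun r hr => (hconst ⟨r, hr.1⟩).mono (Ici_subset_Ici.2 hr.1)) s ⟨s.2, le_rfl⟩
  simp only [h0, hW] at h1
  exact inv_eq_one.1 h1

theorem continuous_of_hasDerivWithinAt_toNNReal {F : Type*} [NormedAddCommGroup F]
    [NormedSpace ℝ F] {u : ℝ≥0 → F} {u' : ℝ≥0 → F}
    (h : ∀ s : ℝ≥0, HasDerivWithinAt (fun r : ℝ => u r.toNNReal) (u' s) (Ici 0) s) :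
    Continuous u := by
  have h1 : ContinuousOn (fun r : ℝ => u r.toNNReal) (Ici 0) := fun r hr =>
    (h ⟨r, hr⟩).continuousWithinAt
  have h2 := h1.comp_continuous NNReal.continuous_coe (fun s => s.2)
  simpa [Function.comp_def] using h2

/-- With determinant one, the `e`-components of the basic relative trajectories are the coefficients
themselves, so the bicharacteristic equations become `a₁' = a₂` and `a₂' = a₃`, and `a₃` is
differentiable as well. -/
theorem ForceConditions.affineFlow (hf : ForceConditions X V α₁ α₂ α₃ α₀ τ₀)
    (hXV : IsBicharacteristic E X V) :
    AffineFlow X V (fun s => α₁ s s 0 0) (fun s => α₂ s s 0 0) (fun s => α₃ s s 0 0)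
      (fun s => X 0 s 0 0) (fun s => V 0 s 0 0) := by
  obtain ⟨e, he⟩ := exists_unit_E3
  have hin : ∀ s k l, _ := hf.inner_trajectory hXV he
  simp only [hf.det_eq_one hXV, div_one] at hin
  have d₁ : ∀ s : ℝ≥0, HasDerivWithinAt (fun r : ℝ => α₁ r.toNNReal r.toNNReal 0 0)
      (α₂ s s 0 0) (Ici 0) s := fun s => by
    have := (hXV.deriv_inner e ((0 : ℝ) • e) ((1 : ℝ) • e) s).1
    simpa only [hin, mul_zero, mul_one, zero_add] using this
  have d₂ : ∀ s : ℝ≥0, HasDerivWithinAt (fun r : ℝ => α₂ r.toNNReal r.toNNReal 0 0)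
      (α₃ s s 0 0) (Ici 0) s := fun s => by
    have := (hXV.deriv_inner e ((1 : ℝ) • e) ((0 : ℝ) • e) s).1
    simpa only [hin, mul_zero, mul_one, add_zero] using this
  have d₃ : ∀ s : ℝ≥0, HasDerivWithinAt (fun r : ℝ => α₃ r.toNNReal r.toNNReal 0 0)
      _ (Ici 0) s := fun s => by
    have := (hXV.deriv_inner e ((1 : ℝ) • e) ((0 : ℝ) • e) s).2
    simpa only [hin, mul_zero, mul_one, add_zero] using this
  have c₁ := continuous_of_hasDerivWithinAt_toNNReal (u := fun s => α₁ s s 0 0) d₁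
  have c₂ := continuous_of_hasDerivWithinAt_toNNReal (u := fun s => α₂ s s 0 0) d₂
  have c₃ := continuous_of_hasDerivWithinAt_toNNReal (u := fun s => α₃ s s 0 0) d₃
  have cX := continuous_of_hasDerivWithinAt_toNNReal (u := fun s => X s 0 0 0)
    fun s => hXV.deriv_X s 0 0 0
  have cV := continuous_of_hasDerivWithinAt_toNNReal (u := fun s => V s 0 0 0)
    fun s => hXV.deriv_V s 0 0 0
  refine ⟨c₁, c₂, c₃, ?_, ?_, hf.det_eq_one hXV, hf.back_X hXV, hf.back_V hXV, hf.invariant_X,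
    hf.invariant_V, hXV.init_X, hXV.init_V, d₁, d₂⟩
  -- The differential equations say nothing directly about the dependence of `X(0;s,·,·)` on `s`;
  -- continuity comes from solving the invariance relation along the trajectory through the origin.
  · have : (fun s => X 0 s 0 0)
        = fun s => α₁ s s 0 0 • V s 0 0 0 - α₂ s s 0 0 • X s 0 0 0 := by
      ext1 s
      have h := hf.invariant_X s 0 0 0
      rw [hf.back_X hXV s, hXV.init_X] at h
      linear_combination (norm := module) h
    rw [this]; exact (c₁.smul cV).sub (c₂.smul cX)
  · have : (fun s => V 0 s 0 0)
        = fun s => α₃ s s 0 0 • X s 0 0 0 - α₂ s s 0 0 • V s 0 0 0 := by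
      ext1 s
      have h := hf.invariant_V s 0 0 0
      rw [hf.back_V hXV s, hXV.init_V] at h
      linear_combination (norm := module) h
    rw [this]; exact (c₃.smul cX).sub (c₂.smul cV)

/-- The alternative in the hypotheses concerns a fixed base point `(t,x,v)`. Taken at `(0,0,0)` it
transfers to the diagonal coefficients, since `αᵢ(s;0,0,0)` and `αᵢ(s;s,0,0)` are coefficients of
the same affine map. -/
theorem ForceConditions.coeff₃_zero_or_ratio (hf : ForceConditions X V α₁ α₂ α₃ α₀ τ₀)
    (hXV : IsBicharacteristic E X V) :
    (∀ s, α₃ s s 0 0 = 0) ∨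
      ∀ s, α₁ s s 0 0 ≤ τ₀ * α₂ s s 0 0 ∧ α₃ s s 0 0 ≤ τ₀ * α₂ s s 0 0 := by
  obtain ⟨e, he⟩ := exists_unit_E3
  have cancel : ∀ k l : ℝ, k • e = l • e → k = l := fun k l h => by
    have := congrArg (fun u => ⟪e, u⟫) h
    simpa only [real_inner_smul_right, he, mul_one] using this
  have e1 : ∀ s, α₁ s 0 0 0 = α₁ s s 0 0 := fun s => by
    have h1 := hf.shift_X s 0 0 0 0 e
    rw [← hf.invariant_X s 0 0 0, hf.back_X hXV s, hf.back_X hXV s (X s 0 0 0)] at h1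
    refine cancel _ _ ?_
    linear_combination (norm := module) -h1
  have e2 : ∀ s, α₂ s 0 0 0 = α₂ s s 0 0 := fun s => by
    have h1 := hf.shift_X s 0 0 0 e 0
    rw [← hf.invariant_X s 0 0 0, hf.back_X hXV s, hf.back_X hXV s (X s 0 0 0)] at h1
    refine cancel _ _ ?_
    linear_combination (norm := module) -h1
  have e3 : ∀ s, α₃ s 0 0 0 = α₃ s s 0 0 := fun s => by
    have h1 := hf.shift_V s 0 0 0 e 0
    rw [← hf.invariant_V s 0 0 0, hf.back_V hXV s, hf.back_V hXV s (X s 0 0 0)] at h1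
    refine cancel _ _ ?_
    linear_combination (norm := module) h1
  rcases hf.ratio 0 0 0 with h | h
  · exact Or.inl fun s => by rw [← e3, h]
  · refine Or.inr fun s => ?_
    have h1 := (div_le_iff₀ (hf.α₂_pos s 0 0 0)).1 (h s)
    rw [e1, e2, e3] at h1
    exact max_le_iff.1 h1

end Derivation

/-- Sign and size conditions on the coefficients of an affine flow. -/
structure CoeffBounds (a₁ a₂ a₃ : ℝ≥0 → ℝ) (α₀ τ₀ : ℝ) : Prop where
  α₀_pos : 0 < α₀
  τ₀_pos : 0 < τ₀
  nonneg₁ : ∀ s, 0 ≤ a₁ s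
  nonneg₃ : ∀ s, 0 ≤ a₃ s
  lower : ∀ s, α₀ ≤ a₂ s
  zero_or_ratio : (∀ s, a₃ s = 0) ∨ ∀ s, a₁ s ≤ τ₀ * a₂ s ∧ a₃ s ≤ τ₀ * a₂ s

theorem ForceConditions.coeffBounds {E : ℝ≥0 → E3 → E3} {X V : Curves} {α₁ α₂ α₃ : Coeff}
    {α₀ τ₀ : ℝ} (hf : ForceConditions X V α₁ α₂ α₃ α₀ τ₀) (hXV : IsBicharacteristic E X V) :
    CoeffBounds (fun s => α₁ s s 0 0) (fun s => α₂ s s 0 0) (fun s => α₃ s s 0 0) α₀ τ₀ where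
  α₀_pos := hf.α₀_pos
  τ₀_pos := hf.τ₀_pos
  nonneg₁ s := by
    rcases eq_or_ne s 0 with rfl | h
    · exact hf.α₁_zero 0 0 0
    · exact (hf.α₁_pos s s 0 0 (pos_iff_ne_zero.2 h)).le
  nonneg₃ s := hf.α₃_nonneg s s 0 0
  lower s := (hf.lower s s 0 0).trans (min_le_right _ _)
  zero_or_ratio := hf.coeff₃_zero_or_ratio hXV

/-- The product Gaussian weight transported along the flow. -/
def wt (p q : ℝ) (X V : Curves) (z : Phase) : ℝ :=
  gauss p (X 0 z.1 z.2.1 z.2.2) * gauss q (V 0 z.1 z.2.1 z.2.2)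

theorem gauss_pos (c : ℝ) (z : E3) : 0 < gauss c z := Real.exp_pos _

theorem wt_pos (p q : ℝ) (X V : Curves) (z : Phase) : 0 < wt p q X V z :=
  mul_pos (gauss_pos _ _) (gauss_pos _ _)

theorem continuous_gauss (c : ℝ) : Continuous (gauss c) := by
  unfold gauss; fun_prop

/-! ### Time integrals of Gaussians along trajectories -/

section Velocity

variable {p q : ℝ}

theorem lintegral_comp_smul_sub {r : ℝ} (hr : 0 < r) (d : E3) {g : E3 → ℝ≥0∞}
    (hg : Measurable g) :
    ∫⁻ y, g y = ENNReal.ofReal (r ^ 3) * ∫⁻ y, g (r • (y - d)) := by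
  rw [lintegral_sub_right_eq_self (fun y => g (r • y)) d]
  have h := Measure.map_addHaar_smul (volume : Measure E3) hr.ne'
  rw [← lintegral_map (μ := volume) hg (measurable_const_smul r), h, lintegral_smul_measure,
    finrank_euclideanSpace_fin, smul_eq_mul, ← mul_assoc, abs_of_pos (by positivity),
    ← ENNReal.ofReal_mul (by positivity), mul_inv_cancel₀ (by positivity)]
  simp

theorem integrable_gauss {c : ℝ} (hc : 0 < c) : Integrable (gauss c) := by
  have h := (GaussianFourier.integrable_cexp_neg_mul_sq_norm_add (V := E3) (b := (c : ℂ))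
    (by simpa using hc) 0 0).norm
  refine h.congr (Filter.Eventually.of_forall fun y => ?_)
  simp [gauss, Complex.norm_exp, ← Complex.ofReal_pow]

/-- Absorbs the linear growth of the collision kernel at the price of half the Gaussian exponent. -/
theorem exp_neg_mul_sq_mul_add_le {κ D r : ℝ} (hκ : 0 < κ) (hD : 0 ≤ D) :
    Real.exp (-κ * r ^ 2) * (D + r) ≤ (D + 1 / κ + 1) * Real.exp (-(κ / 2) * r ^ 2) := by
  have h1 : Real.exp (-κ * r ^ 2)
      = Real.exp (-(κ / 2) * r ^ 2) * Real.exp (-(κ / 2) * r ^ 2) := by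
    rw [← Real.exp_add]; ring_nf
  have h2 : Real.exp (-(κ / 2) * r ^ 2) * Real.exp (κ / 2 * r ^ 2) = 1 := by
    rw [← Real.exp_add]; simp
  have h3 := Real.add_one_le_exp (κ / 2 * r ^ 2)
  set F := Real.exp (-(κ / 2) * r ^ 2)
  have hF : 0 < F := Real.exp_pos _
  have h4 : D + r ≤ (D + 1 / κ + 1) * Real.exp (κ / 2 * r ^ 2) := by
    have h5 : r ^ 2 / 2 ≤ 1 / κ * Real.exp (κ / 2 * r ^ 2) := by
      rw [div_mul_eq_mul_div, one_mul, le_div_iff₀ hκ]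
      linarith
    have h6 : 1 ≤ Real.exp (κ / 2 * r ^ 2) := Real.one_le_exp (by positivity)
    nlinarith [sq_nonneg (r - 1)]
  calc Real.exp (-κ * r ^ 2) * (D + r) = F * F * (D + r) := by rw [h1]
    _ ≤ F * F * ((D + 1 / κ + 1) * Real.exp (κ / 2 * r ^ 2)) := by gcongr
    _ = (D + 1 / κ + 1) * F * (F * Real.exp (κ / 2 * r ^ 2)) := by ring
    _ = (D + 1 / κ + 1) * F := by rw [h2, mul_one]

/-- Bound of a time integral by an integral over the line through an injective substitution. -/
theorem lintegral_comp_injOn_le {φ φ' : ℝ → ℝ} (hφ : ∀ s ∈ Ioi (0 : ℝ), HasDerivAt φ (φ' s) s)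
    (hpos : ∀ s ∈ Ioi (0 : ℝ), 0 < φ' s) (S : Set ℝ) (hS : MapsTo φ (Ioi 0) S) (g : ℝ → ℝ≥0∞) :
    ∫⁻ s in Ioi 0, ENNReal.ofReal (φ' s) * g (φ s) ≤ ∫⁻ r in S, g r := by
  have hmono : StrictMonoOn φ (Ioi 0) := by
    refine strictMonoOn_of_deriv_pos (convex_Ioi 0)
      (fun s hs => (hφ s hs).continuousAt.continuousWithinAt) fun s hs => ?_
    rw [interior_Ioi] at hs
    rw [(hφ s hs).deriv]
    exact hpos s hs
  have h := lintegral_image_eq_lintegral_abs_deriv_mul measurableSet_Ioi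
    (fun s hs => (hφ s hs).hasDerivWithinAt) hmono.injOn g
  calc ∫⁻ s in Ioi 0, ENNReal.ofReal (φ' s) * g (φ s)
      = ∫⁻ s in Ioi 0, ENNReal.ofReal |φ' s| * g (φ s) :=
        setLIntegral_congr_fun measurableSet_Ioi fun s hs => by
          simp only [abs_of_pos (hpos s hs)]
    _ = ∫⁻ r in φ '' Ioi 0, g r := h.symm
    _ ≤ ∫⁻ r in S, g r := lintegral_mono_set hS.image_subset

theorem sq_inner_div_norm_le (w y : E3) : (⟪w, y⟫ / ‖y‖) ^ 2 ≤ ‖w‖ ^ 2 := by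
  rcases eq_or_ne y 0 with rfl | hy
  · simp
  · have hy' : 0 < ‖y‖ := norm_pos_iff.2 hy
    rw [div_pow, div_le_iff₀ (by positivity), ← mul_pow, ← sq_abs]
    exact pow_le_pow_left₀ (abs_nonneg _) (abs_real_inner_le_norm w y) 2

theorem norm_sq_le_two_mul (w d : E3) : ‖w‖ ^ 2 ≤ 2 * ‖w + d‖ ^ 2 + 2 * ‖d‖ ^ 2 := by
  have h : ‖w‖ ≤ ‖w + d‖ + ‖d‖ := by simpa using norm_sub_le (w + d) d
  nlinarith [norm_nonneg w, sq_nonneg (‖w + d‖ - ‖d‖)]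

variable {X V : Curves} {a₁ a₂ a₃ : ℝ≥0 → ℝ} {b c : ℝ≥0 → E3} {α₀ τ₀ : ℝ}

/-- The numerator in the quotient rule is the determinant, hence `1`. -/
theorem AffineFlow.hasDerivAt_ratio (hA : AffineFlow X V a₁ a₂ a₃ b c)
    (hB : CoeffBounds a₁ a₂ a₃ α₀ τ₀) {s : ℝ} (hs : 0 < s) :
    HasDerivAt (fun r : ℝ => a₁ r.toNNReal / a₂ r.toNNReal) ((a₂ s.toNNReal ^ 2)⁻¹) s := by
  lift s to ℝ≥0 using hs.le
  have h1 := (hA.deriv₁ s).hasDerivAt (Ici_mem_nhds hs)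
  have h2 := (hA.deriv₂ s).hasDerivAt (Ici_mem_nhds hs)
  have h0 : a₂ (s : ℝ).toNNReal ≠ 0 := (hB.α₀_pos.trans_le (hB.lower _)).ne'
  refine (h1.fun_div h2 h0).congr_deriv ?_
  simp only [Real.toNNReal_coe]
  rw [show a₂ s * a₂ s - a₁ s * a₃ s = 1 by rw [← hA.det s]; ring, one_div]

/-- If `a₃` does not vanish identically, the clock `τ = a₁/a₂` stays in `[0, τ₀]`, while `a₃ ≤ τ₀
a₂` and `a₂ ≥ α₀` give `a₃/a₂⁴ ≤ (τ₀/α₀) a₂⁻²`, a multiple of `dτ/ds`. -/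
theorem AffineFlow.lintegral_coeff₃_le (hA : AffineFlow X V a₁ a₂ a₃ b c)
    (hB : CoeffBounds a₁ a₂ a₃ α₀ τ₀) :
    ∫⁻ s in Ioi (0 : ℝ), ENNReal.ofReal (a₃ s.toNNReal / a₂ s.toNNReal ^ 4)
      ≤ ENNReal.ofReal (τ₀ / α₀ * τ₀) := by
  have ha := hB.α₀_pos
  rcases hB.zero_or_ratio with h | h
  · simp [h]
  · have hpos : ∀ s, 0 < a₂ s := fun s => ha.trans_le (hB.lower s)
    calc ∫⁻ s in Ioi (0 : ℝ), ENNReal.ofReal (a₃ s.toNNReal / a₂ s.toNNReal ^ 4)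
        ≤ ∫⁻ s in Ioi (0 : ℝ), ENNReal.ofReal ((a₂ s.toNNReal ^ 2)⁻¹)
            * ENNReal.ofReal (τ₀ / α₀) := by
          refine lintegral_mono fun s => ?_
          have h2 := hpos s.toNNReal
          simp only
          rw [← ENNReal.ofReal_mul (by positivity)]
          refine ENNReal.ofReal_le_ofReal ?_
          rw [div_le_iff₀ (by positivity)]
          have : (a₂ s.toNNReal ^ 2)⁻¹ * (τ₀ / α₀) * a₂ s.toNNReal ^ 4
              = τ₀ * a₂ s.toNNReal * (a₂ s.toNNReal / α₀) := by
            field_simp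
          rw [this]
          have h3 : 1 ≤ a₂ s.toNNReal / α₀ := (one_le_div ha).2 (hB.lower _)
          have h4 := (h s.toNNReal).2
          have h5 : 0 ≤ τ₀ * a₂ s.toNNReal := (hB.nonneg₃ _).trans h4
          nlinarith
      _ ≤ ∫⁻ _ in Icc 0 τ₀, ENNReal.ofReal (τ₀ / α₀) :=
          lintegral_comp_injOn_le (φ := fun r : ℝ => a₁ r.toNNReal / a₂ r.toNNReal)
            (fun s hs => hA.hasDerivAt_ratio hB hs)
            (fun s _ => by have := hpos s.toNNReal; positivity) (Icc 0 τ₀)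
            (fun s _ => ⟨div_nonneg (hB.nonneg₁ _) (hpos _).le,
              (div_le_iff₀ (hpos _)).2 (h s.toNNReal).1⟩) _
      _ = ENNReal.ofReal (τ₀ / α₀ * τ₀) := by
          rw [setLIntegral_const, Real.volume_Icc, sub_zero,
            ← ENNReal.ofReal_mul (div_nonneg hB.τ₀_pos.le ha.le)]

theorem lintegral_exp_neg_half_sq (hp : 0 < p) :
    ∫⁻ r : ℝ, ENNReal.ofReal (Real.exp (-(p / 2) * r ^ 2)) = ENNReal.ofReal √(Real.pi / (p / 2)) := by
  rw [← integral_gaussian (p / 2), ofReal_integral_eq_lintegral_ofReal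
    (integrable_exp_neg_mul_sq (by positivity)) (Filter.Eventually.of_forall fun _ => by positivity)]

/-- Time integrability along a moving straight line, uniformly in the line. -/
theorem AffineFlow.lintegral_line_le (hA : AffineFlow X V a₁ a₂ a₃ b c)
    (hB : CoeffBounds a₁ a₂ a₃ α₀ τ₀) (hp : 0 < p) (z y d : E3) :
    ∫⁻ s in Ioi (0 : ℝ), ENNReal.ofReal (gauss p (z + (a₁ s.toNNReal / a₂ s.toNNReal) • y
        + (a₂ s.toNNReal)⁻¹ • d) * (‖y‖ / a₂ s.toNNReal ^ 4))
      ≤ ENNReal.ofReal (Real.exp (p * ‖d‖ ^ 2 / α₀ ^ 2) / α₀ ^ 2 * √(Real.pi / (p / 2))) := by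
  have ha := hB.α₀_pos
  have hpos : ∀ s, 0 < a₂ s := fun s => ha.trans_le (hB.lower s)
  rcases eq_or_ne y 0 with rfl | hy
  · simp
  have hy' : 0 < ‖y‖ := norm_pos_iff.2 hy
  set K := Real.exp (p * ‖d‖ ^ 2 / α₀ ^ 2) / α₀ ^ 2 with hK
  have hK0 : 0 ≤ K := by positivity
  -- The component of `z + τy` in the direction of `y`. It has derivative `a₂⁻²‖y‖`, so it serves as
  -- integration variable and uses up the factor `‖y‖`.
  set φ : ℝ → ℝ := fun s => ⟪z, y⟫ / ‖y‖ + a₁ s.toNNReal / a₂ s.toNNReal * ‖y‖ with hφ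
  have hpt : ∀ s : ℝ, gauss p (z + (a₁ s.toNNReal / a₂ s.toNNReal) • y
        + (a₂ s.toNNReal)⁻¹ • d) * (‖y‖ / a₂ s.toNNReal ^ 4)
      ≤ K * (((a₂ s.toNNReal ^ 2)⁻¹ * ‖y‖) * Real.exp (-(p / 2) * φ s ^ 2)) := by
    intro s
    have h2 := hpos s.toNNReal
    have hl := hB.lower s.toNNReal
    set τ := a₁ s.toNNReal / a₂ s.toNNReal
    set r := a₂ s.toNNReal
    have hφs : φ s = ⟪z + τ • y, y⟫ / ‖y‖ := by
      simp only [hφ, inner_add_left, real_inner_smul_left, real_inner_self_eq_norm_sq]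
      rw [add_div, sq, mul_div_assoc, mul_div_cancel_right₀ _ hy'.ne']
    -- Projecting onto `y` and discarding the shift `a₂⁻¹d` costs half the exponent and the factor
    -- `exp (p‖d‖²/α₀²)`.
    have e1 : φ s ^ 2 ≤ 2 * ‖z + τ • y + r⁻¹ • d‖ ^ 2 + 2 * (‖d‖ ^ 2 / α₀ ^ 2) := by
      rw [hφs]
      refine (sq_inner_div_norm_le _ _).trans ((norm_sq_le_two_mul _ (r⁻¹ • d)).trans ?_)
      have : ‖r⁻¹ • d‖ ^ 2 ≤ ‖d‖ ^ 2 / α₀ ^ 2 := by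
        rw [norm_smul, norm_inv, Real.norm_of_nonneg h2.le, mul_pow, inv_pow, mul_comm,
          ← div_eq_mul_inv]
        gcongr
      linarith
    have e2 : gauss p (z + τ • y + r⁻¹ • d)
        ≤ Real.exp (p * ‖d‖ ^ 2 / α₀ ^ 2) * Real.exp (-(p / 2) * φ s ^ 2) := by
      rw [gauss, ← Real.exp_add, Real.exp_le_exp, mul_div_assoc]
      nlinarith
    have e3 : ‖y‖ / r ^ 4 ≤ (α₀ ^ 2)⁻¹ * ((r ^ 2)⁻¹ * ‖y‖) := by
      rw [show ‖y‖ / r ^ 4 = (r ^ 2)⁻¹ * ((r ^ 2)⁻¹ * ‖y‖) by field_simp]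
      gcongr
    calc _ ≤ (Real.exp (p * ‖d‖ ^ 2 / α₀ ^ 2) * Real.exp (-(p / 2) * φ s ^ 2))
          * ((α₀ ^ 2)⁻¹ * ((r ^ 2)⁻¹ * ‖y‖)) :=
        mul_le_mul e2 e3 (by positivity) (by positivity)
      _ = _ := by rw [hK]; ring
  calc _ ≤ ∫⁻ s in Ioi (0 : ℝ), ENNReal.ofReal K * (ENNReal.ofReal ((a₂ s.toNNReal ^ 2)⁻¹ * ‖y‖)
          * ENNReal.ofReal (Real.exp (-(p / 2) * φ s ^ 2))) := by
        refine lintegral_mono fun s => ?_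
        have h2 := hpos s.toNNReal
        simp only
        rw [← ENNReal.ofReal_mul (by positivity), ← ENNReal.ofReal_mul hK0]
        exact ENNReal.ofReal_le_ofReal (hpt s)
    _ = ENNReal.ofReal K * ∫⁻ s in Ioi (0 : ℝ), ENNReal.ofReal ((a₂ s.toNNReal ^ 2)⁻¹ * ‖y‖)
          * ENNReal.ofReal (Real.exp (-(p / 2) * φ s ^ 2)) :=
        lintegral_const_mul' _ _ ENNReal.ofReal_ne_top
    _ ≤ ENNReal.ofReal K * ∫⁻ r : ℝ in univ, ENNReal.ofReal (Real.exp (-(p / 2) * r ^ 2)) := by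
        refine mul_le_mul_right ?_ _
        refine lintegral_comp_injOn_le (φ := φ) (fun s hs => ?_)
          (fun s _ => by have := hpos s.toNNReal; positivity) univ (mapsTo_univ _ _)
          (fun r => ENNReal.ofReal (Real.exp (-(p / 2) * r ^ 2)))
        exact ((hA.hasDerivAt_ratio hB hs).mul_const ‖y‖).const_add _
    _ = _ := by
        rw [setLIntegral_univ, lintegral_exp_neg_half_sq hp, ENNReal.ofReal_mul hK0]

/-- The constant bounding the time integral of the collision frequency in one direction. -/
def lineConst (p α₀ τ₀ r : ℝ) : ℝ :=
  Real.exp (p * r ^ 2 / α₀ ^ 2) / α₀ ^ 2 * √(Real.pi / (p / 2)) + r * (τ₀ / α₀ * τ₀)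

/-- The substitution `η = a₂⁻¹(y - a₃d)`, with Jacobian `a₂⁻³`, frees the velocity Gaussian of `s`.
As the determinant is one, the position becomes `z + (a₁/a₂)y + a₂⁻¹d`, a line in the clock. After
Tonelli, the part `‖y‖` of the bound for `‖η‖` is treated by `lintegral_line_le` and the part
`a₃‖d‖` by `lintegral_coeff₃_le`. -/
theorem AffineFlow.lintegral_direction_le (hA : AffineFlow X V a₁ a₂ a₃ b c)
    (hB : CoeffBounds a₁ a₂ a₃ α₀ τ₀) (hp : 0 < p) (z u d : E3) :
    ∫⁻ s in Ioi (0 : ℝ), ∫⁻ η : E3, ENNReal.ofReal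
        (gauss p (z + a₁ s.toNNReal • η + a₂ s.toNNReal • d)
          * gauss q (u - a₂ s.toNNReal • η - a₃ s.toNNReal • d) * ‖η‖)
      ≤ ENNReal.ofReal (lineConst p α₀ τ₀ ‖d‖) * ∫⁻ y : E3, ENNReal.ofReal (gauss q y) := by
  have ha := hB.α₀_pos
  have hpos : ∀ s, 0 < a₂ s := fun s => ha.trans_le (hB.lower s)
  have m1 := hA.cont₁.measurable
  have m2 := hA.cont₂.measurable
  have m3 := hA.cont₃.measurable
  have mt := measurable_real_toNNReal
  have mg : ∀ k, Measurable (gauss k) := fun k => (continuous_gauss k).measurable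
  have hsub : ∀ s : ℝ≥0, ∫⁻ η : E3, ENNReal.ofReal
        (gauss p (z + a₁ s • η + a₂ s • d) * gauss q (u - a₂ s • η - a₃ s • d) * ‖η‖)
      ≤ ∫⁻ y : E3, ENNReal.ofReal (gauss q (u - y))
          * (ENNReal.ofReal (gauss p (z + (a₁ s / a₂ s) • y + (a₂ s)⁻¹ • d) * (‖y‖ / a₂ s ^ 4))
            + ENNReal.ofReal ‖d‖ * ENNReal.ofReal (a₃ s / a₂ s ^ 4)) := by
    intro s
    have h2 := hpos s
    have hgm : Measurable fun η : E3 => ENNReal.ofReal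
        (gauss p (z + a₁ s • η + a₂ s • d) * gauss q (u - a₂ s • η - a₃ s • d) * ‖η‖) := by
      have := mg p; have := mg q; fun_prop
    rw [lintegral_comp_smul_sub (inv_pos.2 h2) (a₃ s • d) hgm,
      ← lintegral_const_mul' _ _ ENNReal.ofReal_ne_top]
    refine lintegral_mono fun y => ?_
    have hdet : a₂ s ^ 2 = 1 + a₁ s * a₃ s := by linarith [hA.det s]
    have e1 : z + a₁ s • (a₂ s)⁻¹ • (y - a₃ s • d) + a₂ s • d
        = z + (a₁ s / a₂ s) • y + (a₂ s)⁻¹ • d := by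
      have : a₂ s = (a₂ s)⁻¹ + a₁ s * a₃ s * (a₂ s)⁻¹ := by
        field_simp; linarith
      have e : a₂ s • d = ((a₂ s)⁻¹ + a₁ s * a₃ s * (a₂ s)⁻¹) • d := by rw [← this]
      rw [e]
      module
    have e2 : u - a₂ s • (a₂ s)⁻¹ • (y - a₃ s • d) - a₃ s • d = u - y := by
      rw [smul_inv_smul₀ h2.ne']; abel
    have e3 : ‖(a₂ s)⁻¹ • (y - a₃ s • d)‖ ≤ (a₂ s)⁻¹ * (‖y‖ + a₃ s * ‖d‖) := by
      rw [norm_smul, norm_inv, Real.norm_of_nonneg h2.le]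
      gcongr
      refine (norm_sub_le _ _).trans ?_
      rw [norm_smul, Real.norm_of_nonneg (hB.nonneg₃ s)]
    simp only
    rw [e1, e2, ← ENNReal.ofReal_mul (norm_nonneg d), ← ENNReal.ofReal_add
      (mul_nonneg (gauss_pos _ _).le (by positivity))
      (mul_nonneg (norm_nonneg d) (div_nonneg (hB.nonneg₃ s) (by positivity))),
      ← ENNReal.ofReal_mul (by positivity), ← ENNReal.ofReal_mul (gauss_pos _ _).le]
    refine ENNReal.ofReal_le_ofReal ?_
    set G := gauss p (z + (a₁ s / a₂ s) • y + (a₂ s)⁻¹ • d)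
    have hG0 : 0 ≤ G := (gauss_pos _ _).le
    have hG1 : G ≤ 1 := Real.exp_le_one_iff.2 (by
      have := sq_nonneg ‖z + (a₁ s / a₂ s) • y + (a₂ s)⁻¹ • d‖
      nlinarith)
    have hQ0 : 0 ≤ gauss q (u - y) := (gauss_pos _ _).le
    have h3 := hB.nonneg₃ s
    calc (a₂ s)⁻¹ ^ 3 * (G * gauss q (u - y) * ‖(a₂ s)⁻¹ • (y - a₃ s • d)‖)
        ≤ (a₂ s)⁻¹ ^ 3 * (G * gauss q (u - y) * ((a₂ s)⁻¹ * (‖y‖ + a₃ s * ‖d‖))) := by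
          gcongr
      _ = gauss q (u - y) * (G * (‖y‖ / a₂ s ^ 4) + G * (‖d‖ * (a₃ s / a₂ s ^ 4))) := by
          field_simp
      _ ≤ gauss q (u - y) * (G * (‖y‖ / a₂ s ^ 4) + 1 * (‖d‖ * (a₃ s / a₂ s ^ 4))) := by
          gcongr
      _ = _ := by rw [one_mul]
  calc _ ≤ ∫⁻ s in Ioi (0 : ℝ), ∫⁻ y : E3, ENNReal.ofReal (gauss q (u - y))
          * (ENNReal.ofReal (gauss p (z + (a₁ s.toNNReal / a₂ s.toNNReal) • y
              + (a₂ s.toNNReal)⁻¹ • d) * (‖y‖ / a₂ s.toNNReal ^ 4))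
            + ENNReal.ofReal ‖d‖ * ENNReal.ofReal (a₃ s.toNNReal / a₂ s.toNNReal ^ 4)) :=
        lintegral_mono fun s => hsub s.toNNReal
    _ = ∫⁻ y : E3, ∫⁻ s in Ioi (0 : ℝ), ENNReal.ofReal (gauss q (u - y))
          * (ENNReal.ofReal (gauss p (z + (a₁ s.toNNReal / a₂ s.toNNReal) • y
              + (a₂ s.toNNReal)⁻¹ • d) * (‖y‖ / a₂ s.toNNReal ^ 4))
            + ENNReal.ofReal ‖d‖ * ENNReal.ofReal (a₃ s.toNNReal / a₂ s.toNNReal ^ 4)) := by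
        refine lintegral_lintegral_swap (Measurable.aemeasurable ?_)
        have := mg p; have := mg q
        simp only [Function.uncurry_def]
        fun_prop
    _ ≤ ∫⁻ y : E3, ENNReal.ofReal (lineConst p α₀ τ₀ ‖d‖) * ENNReal.ofReal (gauss q (u - y)) := by
        refine lintegral_mono fun y => ?_
        simp only
        have := mg p
        rw [lintegral_const_mul' _ _ ENNReal.ofReal_ne_top, mul_comm, lintegral_add_right _
          (by fun_prop), lintegral_const_mul' _ _ ENNReal.ofReal_ne_top, lineConst,
          ENNReal.ofReal_add (by positivity) (by have := hB.τ₀_pos; positivity),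
          ENNReal.ofReal_mul (p := ‖d‖) (norm_nonneg d)]
        gcongr
        · exact hA.lintegral_line_le hB hp z y d
        · exact hA.lintegral_coeff₃_le hB
    _ = _ := by
        rw [lintegral_const_mul' _ _ ENNReal.ofReal_ne_top,
          lintegral_sub_left_eq_self (fun y => ENNReal.ofReal (gauss q y)) u]

end Velocity

/-! ### The flow, the collision frequency and its time integral -/

section Majorant

variable {p q : ℝ} {X V : Curves} {a₁ a₂ a₃ : ℝ≥0 → ℝ} {b c : ℝ≥0 → E3} {α₀ τ₀ : ℝ}

instance : IsFiniteMeasure surf := inferInstanceAs (IsFiniteMeasure (volume : Measure E3).toSphere)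

/-- The state at time `s` of the trajectory through the phase space point `z`. -/
def flow (X V : Curves) (s : ℝ≥0) (z : Phase) : Phase :=
  (s, X s z.1 z.2.1 z.2.2, V s z.1 z.2.1 z.2.2)

/-- Inverts the backward map, whose determinant is one. This gives joint continuity of the flow,
where the differential equations only give continuity in `s`. -/
theorem AffineFlow.flow_eq (hA : AffineFlow X V a₁ a₂ a₃ b c) (s : ℝ≥0) (z : Phase) :
    flow X V s z = (s,
      a₂ s • (X 0 z.1 z.2.1 z.2.2 - b s) + a₁ s • (V 0 z.1 z.2.1 z.2.2 - c s),
      a₃ s • (X 0 z.1 z.2.1 z.2.2 - b s) + a₂ s • (V 0 z.1 z.2.1 z.2.2 - c s)) := by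
  obtain ⟨t, x, v⟩ := z
  simp only [flow, Prod.mk.injEq, true_and]
  rw [← hA.invariant_X s t x v, ← hA.invariant_V s t x v, hA.back_X s, hA.back_V s]
  have h := hA.det s
  generalize X s t x v = P
  generalize V s t x v = U
  constructor
  · rw [← sub_eq_zero, show P - (a₂ s • (b s + a₂ s • P - a₁ s • U - b s)
      + a₁ s • (c s + a₂ s • U - a₃ s • P - c s)) = (1 - (a₂ s ^ 2 - a₁ s * a₃ s)) • P by module,
      h, sub_self, zero_smul]
  · rw [← sub_eq_zero, show U - (a₃ s • (b s + a₂ s • P - a₁ s • U - b s)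
      + a₂ s • (c s + a₂ s • U - a₃ s • P - c s)) = (1 - (a₂ s ^ 2 - a₁ s * a₃ s)) • U by module,
      h, sub_self, zero_smul]

theorem AffineFlow.continuous_back_X (hA : AffineFlow X V a₁ a₂ a₃ b c) :
    Continuous fun z : Phase => X 0 z.1 z.2.1 z.2.2 := by
  have h1 := hA.cont₁; have h2 := hA.cont₂; have h3 := hA.cont_b
  simp only [hA.back_X]; fun_prop

theorem AffineFlow.continuous_back_V (hA : AffineFlow X V a₁ a₂ a₃ b c) :
    Continuous fun z : Phase => V 0 z.1 z.2.1 z.2.2 := by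
  have h1 := hA.cont₂; have h2 := hA.cont₃; have h3 := hA.cont_c
  simp only [hA.back_V]; fun_prop

theorem AffineFlow.continuous_flow (hA : AffineFlow X V a₁ a₂ a₃ b c) :
    Continuous fun y : ℝ≥0 × Phase => flow X V y.1 y.2 := by
  have h1 := hA.cont₁; have h2 := hA.cont₂; have h3 := hA.cont₃
  have h4 := hA.cont_b; have h5 := hA.cont_c
  have h6 := hA.continuous_back_X.comp (continuous_snd (X := ℝ≥0))
  have h7 := hA.continuous_back_V.comp (continuous_snd (X := ℝ≥0))
  simp only [Function.comp_def] at h6 h7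
  simp only [hA.flow_eq]
  exact continuous_fst.prodMk
    ((((h2.comp continuous_fst).smul (h6.sub (h4.comp continuous_fst))).add
      ((h1.comp continuous_fst).smul (h7.sub (h5.comp continuous_fst)))).prodMk
    (((h3.comp continuous_fst).smul (h6.sub (h4.comp continuous_fst))).add
      ((h2.comp continuous_fst).smul (h7.sub (h5.comp continuous_fst)))))

theorem AffineFlow.continuous_flow_comp (hA : AffineFlow X V a₁ a₂ a₃ b c) {T : Type*}
    [TopologicalSpace T] {u : T → ℝ≥0} {w : T → Phase} (hu : Continuous u) (hw : Continuous w) :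
    Continuous fun y => flow X V (u y) (w y) :=
  hA.continuous_flow.comp (hu.prodMk hw)

theorem AffineFlow.flow_flow (hA : AffineFlow X V a₁ a₂ a₃ b c) (s r : ℝ≥0) (z : Phase) :
    flow X V s (flow X V r z) = flow X V s z := by
  rw [hA.flow_eq, hA.flow_eq s z]
  simp only [flow, hA.invariant_X, hA.invariant_V]

theorem AffineFlow.flow_self (hA : AffineFlow X V a₁ a₂ a₃ b c) (z : Phase) :
    flow X V z.1 z = z := by
  simp only [flow, hA.init_X, hA.init_V]

theorem AffineFlow.wt_flow (hA : AffineFlow X V a₁ a₂ a₃ b c) (s : ℝ≥0) (z : Phase) :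
    wt p q X V (flow X V s z) = wt p q X V z := by
  simp only [wt, flow, hA.invariant_X, hA.invariant_V]

theorem AffineFlow.continuous_wt (hA : AffineFlow X V a₁ a₂ a₃ b c) :
    Continuous (wt p q X V) :=
  ((continuous_gauss p).comp hA.continuous_back_X).mul
    ((continuous_gauss q).comp hA.continuous_back_V)

/-- The majorant of the collision integrands, as a function of `(w, ω)`. -/
def maj (p q : ℝ) (X V : Curves) (k : ℝ) (z : Phase) (y : E3 × S2) : ℝ :=
  wt p q X V (z.1, z.2.1 + k • (y.2 : E3), y.1) * ‖z.2.2 - y.1‖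

theorem maj_nonneg (k : ℝ) (z : Phase) (y : E3 × S2) : 0 ≤ maj p q X V k z y :=
  mul_nonneg (wt_pos _ _ _ _ _).le (norm_nonneg _)

theorem AffineFlow.continuous_maj (hA : AffineFlow X V a₁ a₂ a₃ b c) (k : ℝ) :
    Continuous fun y : Phase × (E3 × S2) => maj p q X V k y.1 y.2 := by
  have h := hA.continuous_wt (p := p) (q := q)
  unfold maj
  fun_prop

theorem AffineFlow.continuous_maj_comp (hA : AffineFlow X V a₁ a₂ a₃ b c) (k : ℝ) {T : Type*}
    [TopologicalSpace T] {u : T → Phase} {w : T → E3 × S2} (hu : Continuous u)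
    (hw : Continuous w) : Continuous fun y => maj p q X V k (u y) (w y) := by
  have h := hA.continuous_wt (p := p) (q := q)
  unfold maj
  fun_prop

theorem AffineFlow.continuous_maj_flow (hA : AffineFlow X V a₁ a₂ a₃ b c) (k : ℝ) (z : Phase) :
    Continuous fun y : ℝ × E3 × S2 => maj p q X V k (flow X V y.1.toNNReal z) y.2 := by
  have hu : Continuous fun y : ℝ × E3 × S2 => y.1.toNNReal :=
    continuous_real_toNNReal.comp continuous_fst
  exact hA.continuous_maj_comp (p := p) (q := q) k (hA.continuous_flow_comp hu continuous_const) continuous_snd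

/-- The collision frequency majorant. -/
def freq (p q : ℝ) (X V : Curves) (k : ℝ) (z : Phase) : ℝ :=
  ∫ y, maj p q X V k z y ∂((volume : Measure E3).prod surf)

theorem freq_nonneg (k : ℝ) (z : Phase) : 0 ≤ freq p q X V k z :=
  integral_nonneg fun y => maj_nonneg k z y

/-- In the relative velocity `η = V - w`, the backward image of the partner is that of the
trajectory shifted linearly by `η` and `kω`, so each direction `ω` falls under
`lintegral_direction_le` with `d = kω`. -/
theorem AffineFlow.lintegral_maj_flow_le (hA : AffineFlow X V a₁ a₂ a₃ b c)
    (hB : CoeffBounds a₁ a₂ a₃ α₀ τ₀) (hp : 0 < p) (k : ℝ) (z : Phase) :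
    ∫⁻ s in Ioi (0 : ℝ), ∫⁻ y, ENNReal.ofReal (maj p q X V k (flow X V s.toNNReal z) y)
        ∂((volume : Measure E3).prod surf)
      ≤ ENNReal.ofReal (lineConst p α₀ τ₀ |k|) * (∫⁻ y : E3, ENNReal.ofReal (gauss q y))
        * surf univ := by
  have hcont := hA.continuous_maj_flow (p := p) (q := q) k z
  have hone : ∀ (s : ℝ≥0) (ω : S2),
      ∫⁻ w : E3, ENNReal.ofReal (maj p q X V k (flow X V s z) (w, ω))
        = ∫⁻ η : E3, ENNReal.ofReal
          (gauss p (X 0 z.1 z.2.1 z.2.2 + a₁ s • η + a₂ s • k • (ω : E3))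
            * gauss q (V 0 z.1 z.2.1 z.2.2 - a₂ s • η - a₃ s • k • (ω : E3)) * ‖η‖) := by
    intro s ω
    refine (lintegral_sub_left_eq_self
      (fun w => ENNReal.ofReal (maj p q X V k (flow X V s z) (w, ω)))
      (V s z.1 z.2.1 z.2.2)).symm.trans ?_
    refine lintegral_congr fun η => ?_
    have h1 := hA.invariant_X s z.1 z.2.1 z.2.2
    have h2 := hA.invariant_V s z.1 z.2.1 z.2.2
    simp only [maj, wt, flow, hA.back_X s, hA.back_V s, sub_sub_cancel] at h1 h2 ⊢
    rw [← h1, ← h2]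
    congr 3
    · congr 1; module
    · congr 1; module
  calc _ = ∫⁻ s in Ioi (0 : ℝ), ∫⁻ ω : S2, (∫⁻ w : E3,
          ENNReal.ofReal (maj p q X V k (flow X V s.toNNReal z) (w, ω))) ∂surf := by
        refine lintegral_congr fun s => ?_
        refine lintegral_prod_symm' _ ?_
        exact (hcont.comp (Continuous.prodMk_right s)).measurable.ennreal_ofReal
    _ = ∫⁻ ω : S2, (∫⁻ s in Ioi (0 : ℝ), ∫⁻ w : E3,
          ENNReal.ofReal (maj p q X V k (flow X V s.toNNReal z) (w, ω))) ∂surf := by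
        refine lintegral_lintegral_swap (Measurable.aemeasurable ?_)
        refine Measurable.lintegral_prod_right' (f := fun y : (ℝ × S2) × E3 =>
          ENNReal.ofReal (maj p q X V k (flow X V y.1.1.toNNReal z) (y.2, y.1.2))) ?_
        have : Continuous fun y : (ℝ × S2) × E3 => (y.1.1, y.2, y.1.2) := by fun_prop
        exact (hcont.comp this).measurable.ennreal_ofReal
    _ ≤ ∫⁻ _ : S2, ENNReal.ofReal (lineConst p α₀ τ₀ |k|)
          * (∫⁻ y : E3, ENNReal.ofReal (gauss q y)) ∂surf := by
        refine lintegral_mono fun ω => ?_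
        simp only [hone]
        refine (hA.lintegral_direction_le hB hp _ _ (k • (ω : E3))).trans_eq ?_
        rw [norm_smul, norm_eq_of_mem_sphere, mul_one, Real.norm_eq_abs]
    _ = _ := by rw [lintegral_const]

/-- Locally in phase space the majorant is dominated by a Gaussian in the velocity. -/
theorem AffineFlow.exists_bound_maj (hA : AffineFlow X V a₁ a₂ a₃ b c)
    (hB : CoeffBounds a₁ a₂ a₃ α₀ τ₀) (hp : 0 < p) (hq : 0 < q) (k : ℝ) (z₀ : Phase) :
    ∃ B : E3 × S2 → ℝ, Integrable B ((volume : Measure E3).prod surf) ∧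
      ∀ᶠ z in nhds z₀, ∀ y, maj p q X V k z y ≤ B y := by
  -- `N` bounds the part of the backward velocity that does not depend on `w`. Near `z₀` it stays
  -- below `M`, and `a₂ ≥ α₀` then yields decay in `w` at rate `q α₀²/2`, halved once more to absorb
  -- `‖v - w‖`.
  set N : Phase → ℝ := fun z => ‖c z.1‖ + a₃ z.1 * (‖z.2.1‖ + |k|) with hN
  have hNc : Continuous N := by
    have h1 := hA.cont_c; have h2 := hA.cont₃; fun_prop
  have ha := hB.α₀_pos
  set M := N z₀ + 1
  set B : E3 × S2 → ℝ := fun y => Real.exp (q * M ^ 2)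
      * ((‖z₀.2.2‖ + 1 + 1 / (q * α₀ ^ 2 / 2) + 1) * gauss (q * α₀ ^ 2 / 2 / 2) y.1) with hBdef
  refine ⟨B, ?_, ?_⟩
  · have h := (integrable_gauss (c := q * α₀ ^ 2 / 2 / 2) (by positivity)).mul_prod
      (integrable_const (1 : ℝ) (μ := surf))
    simp only [mul_one] at h
    exact (h.const_mul _).const_mul _
  · have e1 : ∀ᶠ z in nhds z₀, N z < M := hNc.continuousAt.eventually_lt_const (by simp [M])
    have e2 : ∀ᶠ z : Phase in nhds z₀, ‖z.2.2‖ < ‖z₀.2.2‖ + 1 :=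
      (by fun_prop : Continuous fun z : Phase => ‖z.2.2‖).continuousAt.eventually_lt_const
        (by simp)
    filter_upwards [e1, e2] with z h1 h2 y
    have hg : gauss p (X 0 z.1 (z.2.1 + k • (y.2 : E3)) y.1) ≤ 1 :=
      Real.exp_le_one_iff.2 (by
        have := sq_nonneg ‖X 0 z.1 (z.2.1 + k • (y.2 : E3)) y.1‖
        nlinarith)
    have hl := hB.lower z.1
    have h3 : ‖c z.1 - a₃ z.1 • (z.2.1 + k • (y.2 : E3))‖ ≤ M := by
      refine le_trans ?_ h1.le
      refine (norm_sub_le _ _).trans ?_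
      rw [norm_smul, Real.norm_of_nonneg (hB.nonneg₃ _)]
      have : ‖z.2.1 + k • (y.2 : E3)‖ ≤ ‖z.2.1‖ + |k| := by
        refine (norm_add_le _ _).trans ?_
        rw [norm_smul, norm_eq_of_mem_sphere, mul_one, Real.norm_eq_abs]
      have h4 := hB.nonneg₃ z.1
      simp only [hN]
      gcongr
    have h5 : ‖a₂ z.1 • y.1‖ ^ 2 ≤ 2 * ‖V 0 z.1 (z.2.1 + k • (y.2 : E3)) y.1‖ ^ 2 + 2 * M ^ 2 := by
      refine (norm_sq_le_two_mul _ (c z.1 - a₃ z.1 • (z.2.1 + k • (y.2 : E3)))).trans ?_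
      rw [hA.back_V z.1, show a₂ z.1 • y.1 + (c z.1 - a₃ z.1 • (z.2.1 + k • (y.2 : E3)))
        = c z.1 + a₂ z.1 • y.1 - a₃ z.1 • (z.2.1 + k • (y.2 : E3)) by abel]
      gcongr
    have h6 : α₀ ^ 2 * ‖y.1‖ ^ 2 ≤ ‖a₂ z.1 • y.1‖ ^ 2 := by
      rw [norm_smul, mul_pow, Real.norm_of_nonneg (ha.le.trans hl)]
      gcongr
    have h7 : gauss q (V 0 z.1 (z.2.1 + k • (y.2 : E3)) y.1)
        ≤ Real.exp (q * M ^ 2) * Real.exp (-(q * α₀ ^ 2 / 2) * ‖y.1‖ ^ 2) := by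
      rw [gauss, ← Real.exp_add, Real.exp_le_exp]
      nlinarith
    have h8 : ‖z.2.2 - y.1‖ ≤ ‖z₀.2.2‖ + 1 + ‖y.1‖ :=
      (norm_sub_le _ _).trans (by linarith)
    calc maj p q X V k z y
        ≤ 1 * (Real.exp (q * M ^ 2) * Real.exp (-(q * α₀ ^ 2 / 2) * ‖y.1‖ ^ 2))
          * (‖z₀.2.2‖ + 1 + ‖y.1‖) := by
          unfold maj wt
          have := (gauss_pos q (V 0 z.1 (z.2.1 + k • (y.2 : E3)) y.1)).le
          gcongr
      _ = Real.exp (q * M ^ 2)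
          * (Real.exp (-(q * α₀ ^ 2 / 2) * ‖y.1‖ ^ 2) * (‖z₀.2.2‖ + 1 + ‖y.1‖)) := by ring
      _ ≤ B y := by
        simp only [hBdef]
        exact mul_le_mul_of_nonneg_left
          (exp_neg_mul_sq_mul_add_le (by positivity) (by positivity)) (Real.exp_pos _).le

/-- A continuous integrand dominated by the majorant is integrable, and its integral depends
continuously on the phase space point. -/
theorem AffineFlow.continuous_integral_of_le_maj (hA : AffineFlow X V a₁ a₂ a₃ b c)
    (hB : CoeffBounds a₁ a₂ a₃ α₀ τ₀) (hp : 0 < p) (hq : 0 < q) {k C : ℝ}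
    {G : Phase → E3 × S2 → ℝ} (hG : Continuous fun y : Phase × (E3 × S2) => G y.1 y.2)
    (hle : ∀ z y, |G z y| ≤ C * maj p q X V k z y) :
    (∀ z, Integrable (G z) ((volume : Measure E3).prod surf)) ∧
      Continuous fun z => ∫ y, G z y ∂((volume : Measure E3).prod surf) := by
  have hC : ∀ z y, |G z y| ≤ |C| * maj p q X V k z y := fun z y =>
    (hle z y).trans (mul_le_mul_of_nonneg_right (le_abs_self C) (maj_nonneg k z y))
  have hm : ∀ z, AEStronglyMeasurable (G z) ((volume : Measure E3).prod surf) := fun z =>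
    (hG.comp (Continuous.prodMk_right z)).aestronglyMeasurable
  constructor
  · intro z
    obtain ⟨B, hBi, hBe⟩ := hA.exists_bound_maj hB hp hq k z
    refine (hBi.const_mul |C|).mono' (hm z) (Filter.Eventually.of_forall fun y => ?_)
    exact (hC z y).trans (mul_le_mul_of_nonneg_left (hBe.self_of_nhds y) (abs_nonneg C))
  · refine continuous_iff_continuousAt.2 fun z₀ => ?_
    obtain ⟨B, hBi, hBe⟩ := hA.exists_bound_maj hB hp hq k z₀
    refine continuousAt_of_dominated (bound := fun y => |C| * B y)
      (Filter.Eventually.of_forall hm) ?_ (hBi.const_mul |C|)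
      (Filter.Eventually.of_forall fun y =>
        (hG.comp (Continuous.prodMk_left y)).continuousAt)
    filter_upwards [hBe] with z hz
    exact Filter.Eventually.of_forall fun y =>
      (hC z y).trans (mul_le_mul_of_nonneg_left (hz y) (abs_nonneg C))

theorem AffineFlow.integrable_maj (hA : AffineFlow X V a₁ a₂ a₃ b c)
    (hB : CoeffBounds a₁ a₂ a₃ α₀ τ₀) (hp : 0 < p) (hq : 0 < q) (k : ℝ) (z : Phase) :
    Integrable (maj p q X V k z) ((volume : Measure E3).prod surf) :=
  (hA.continuous_integral_of_le_maj hB hp hq (C := 1) (hA.continuous_maj k) fun z y => by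
    rw [abs_of_nonneg (maj_nonneg k z y), one_mul]).1 z

theorem AffineFlow.continuous_freq (hA : AffineFlow X V a₁ a₂ a₃ b c)
    (hB : CoeffBounds a₁ a₂ a₃ α₀ τ₀) (hp : 0 < p) (hq : 0 < q) (k : ℝ) :
    Continuous (freq p q X V k) :=
  (hA.continuous_integral_of_le_maj hB hp hq (C := 1) (hA.continuous_maj k) fun z y => by
    rw [abs_of_nonneg (maj_nonneg k z y), one_mul]).2

/-- The collision frequency is integrable along trajectories, uniformly. -/
theorem AffineFlow.exists_integral_freq_le (hA : AffineFlow X V a₁ a₂ a₃ b c)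
    (hB : CoeffBounds a₁ a₂ a₃ α₀ τ₀) (hp : 0 < p) (hq : 0 < q) (k : ℝ) :
    ∃ K : ℝ, 0 ≤ K ∧ ∀ (z : Phase) (t : ℝ≥0),
      ∫ s in (0 : ℝ)..t, freq p q X V k (flow X V s.toNNReal z) ≤ K := by
  set K := ENNReal.ofReal (lineConst p α₀ τ₀ |k|) * (∫⁻ y : E3, ENNReal.ofReal (gauss q y))
        * surf univ
  have hK : K ≠ ∞ := ENNReal.mul_ne_top
    (ENNReal.mul_ne_top ENNReal.ofReal_ne_top (integrable_gauss hq).lintegral_lt_top.ne)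
    (measure_ne_top _ _)
  refine ⟨K.toReal, ENNReal.toReal_nonneg, fun z t => ?_⟩
  have hc : Continuous fun s : ℝ => freq p q X V k (flow X V s.toNNReal z) :=
    (hA.continuous_freq hB hp hq k).comp (hA.continuous_flow_comp
      continuous_real_toNNReal continuous_const)
  rw [intervalIntegral.integral_of_le t.coe_nonneg]
  rw [integral_eq_lintegral_of_nonneg_ae (Filter.Eventually.of_forall fun s => freq_nonneg k _)
    hc.aestronglyMeasurable]
  refine ENNReal.toReal_mono hK ?_
  refine le_trans ?_ (hA.lintegral_maj_flow_le hB hp k z)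
  refine (lintegral_mono_set Ioc_subset_Ioi_self).trans (lintegral_mono fun s => ?_)
  simp only [freq]
  rw [ofReal_integral_eq_lintegral_ofReal (hA.integrable_maj hB hp hq k _)
    (Filter.Eventually.of_forall fun y => maj_nonneg k _ y)]

end Majorant

/-! ### Weighted Lipschitz estimates for the collision operator -/

section Collision

variable {p q : ℝ} {X V : Curves} {a₁ a₂ a₃ : ℝ≥0 → ℝ} {b c : ℝ≥0 → E3} {α₀ τ₀ : ℝ}
variable {a : ℝ}

theorem wnorm_le_iff {g : Phase → ℝ} {R : ℝ≥0} :
    wnorm p q X V g ≤ R ↔ ∀ z, |g z| ≤ R * wt p q X V z := by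
  simp only [wnorm, iSup_le_iff, wt]
  refine forall_congr' fun z => ?_
  rw [← ENNReal.ofReal_coe_nnreal, ENNReal.ofReal_le_ofReal_iff R.coe_nonneg, mul_assoc,
    ← mul_inv, ← div_eq_mul_inv, div_le_iff₀ (mul_pos (gauss_pos _ _) (gauss_pos _ _))]

theorem wt_le_one (hp : 0 < p) (hq : 0 < q) (z : Phase) : wt p q X V z ≤ 1 := by
  have h : ∀ {k : ℝ}, 0 < k → ∀ x : E3, gauss k x ≤ 1 := fun {k} hk x =>
    Real.exp_le_one_iff.2 (by nlinarith [sq_nonneg ‖x‖])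
  exact mul_le_one₀ (h hp _) (gauss_pos _ _).le (h hq _)

/-- The gain integrand, extended by `0` outside of the collision domain. -/
def gainI (a : ℝ) (Φ : C(ℝ≥0 × E3 × S2, ℝ)) (f : C(Phase, ℝ)) (z : Phase) (y : E3 × S2) : ℝ :=
  Φ (z.1, z.2.1, y.2) * f (z.1, z.2.1, velV z.2.2 y.1 y.2)
    * f (z.1, z.2.1 - a • (y.2 : E3), velW z.2.2 y.1 y.2) * max (kernelB (z.2.2 - y.1) y.2) 0

/-- The loss integrand, extended by `0` outside of the collision domain, with the density
at the point `z` and the density of the collision partners kept apart. -/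
def lossI (a : ℝ) (Φ : C(ℝ≥0 × E3 × S2, ℝ)) (f g : C(Phase, ℝ)) (z : Phase) (y : E3 × S2) : ℝ :=
  Φ (z.1, z.2.1, y.2) * f z * g (z.1, z.2.1 + a • (y.2 : E3), y.1)
    * max (kernelB (z.2.2 - y.1) y.2) 0

theorem continuous_kernelB : Continuous fun y : Phase × (E3 × S2) =>
    kernelB (y.1.2.2 - y.2.1) y.2.2 := by
  unfold kernelB; fun_prop

theorem continuous_gainI (Φ : C(ℝ≥0 × E3 × S2, ℝ)) (f : C(Phase, ℝ)) :
    Continuous fun y : Phase × (E3 × S2) => gainI a Φ f y.1 y.2 := by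
  have h := continuous_kernelB
  unfold gainI velV velW
  fun_prop

theorem continuous_lossI (Φ : C(ℝ≥0 × E3 × S2, ℝ)) (f g : C(Phase, ℝ)) :
    Continuous fun y : Phase × (E3 × S2) => lossI a Φ f g y.1 y.2 := by
  have h := continuous_kernelB
  unfold lossI
  fun_prop

/-- The two sides differ by exactly `2⟪P - S + δ, δ⟫`. -/
theorem norm_sq_add_norm_sq_le {P S δ : E3} (h : 0 ≤ ⟪P - S + δ, δ⟫) :
    ‖P‖ ^ 2 + ‖S‖ ^ 2 ≤ ‖P + δ‖ ^ 2 + ‖S - δ‖ ^ 2 := by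
  rw [norm_add_sq_real, norm_sub_sq_real]
  rw [inner_add_left, inner_sub_left, real_inner_self_eq_norm_sq] at h
  nlinarith [sq_nonneg ‖δ‖]

theorem gauss_mul_gauss_le {k : ℝ} (hk : 0 < k) {P S δ : E3} (h : 0 ≤ ⟪P - S + δ, δ⟫) :
    gauss k (P + δ) * gauss k (S - δ) ≤ gauss k P * gauss k S := by
  have := norm_sq_add_norm_sq_le h
  simp only [gauss, ← Real.exp_add, Real.exp_le_exp]
  nlinarith

theorem real_inner_sphere_self (ω : S2) : ⟪(ω : E3), (ω : E3)⟫ = 1 := by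
  rw [real_inner_self_eq_norm_sq, norm_eq_of_mem_sphere, one_pow]

/-- The product of the weights does not increase in a collision. -/
theorem AffineFlow.wt_velV_mul_wt_velW_le (hA : AffineFlow X V a₁ a₂ a₃ b c)
    (hB : CoeffBounds a₁ a₂ a₃ α₀ τ₀) (hp : 0 < p) (hq : 0 < q) (ha : 0 ≤ a) (t : ℝ≥0)
    (x v w : E3) (ω : S2) (h : 0 ≤ kernelB (v - w) ω) :
    wt p q X V (t, x, velV v w ω) * wt p q X V (t, x - a • (ω : E3), velW v w ω)
      ≤ wt p q X V (t, x, v) * wt p q X V (t, x + (-a) • (ω : E3), w) := by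
  have h1 := hB.nonneg₁ t
  have h2 := hB.α₀_pos.le.trans (hB.lower t)
  have h3 := hB.nonneg₃ t
  have hω := real_inner_sphere_self ω
  set β := kernelB (v - w) ω with hβ
  have hβ' : ⟪v, (ω : E3)⟫ - ⟪w, (ω : E3)⟫ = β := by rw [hβ, kernelB, inner_sub_left]
  set P := X 0 t x v
  set S := X 0 t (x + (-a) • (ω : E3)) w
  set P' := V 0 t x v
  set S' := V 0 t (x + (-a) • (ω : E3)) w
  have eX1 : X 0 t x (velV v w ω) = P + (a₁ t * β) • (ω : E3) := by
    simp only [P, hA.back_X t, velV, ← hβ]; module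
  have eX2 : X 0 t (x - a • (ω : E3)) (velW v w ω) = S - (a₁ t * β) • (ω : E3) := by
    simp only [S, hA.back_X t, velW, ← hβ]; module
  have eV1 : V 0 t x (velV v w ω) = P' + (-(a₂ t * β)) • (ω : E3) := by
    simp only [P', hA.back_V t, velV, ← hβ]; module
  have eV2 : V 0 t (x - a • (ω : E3)) (velW v w ω) = S' - (-(a₂ t * β)) • (ω : E3) := by
    simp only [S', hA.back_V t, velW, ← hβ]; module
  have hX : gauss p (X 0 t x (velV v w ω)) * gauss p (X 0 t (x - a • (ω : E3)) (velW v w ω))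
      ≤ gauss p P * gauss p S := by
    rw [eX1, eX2]
    refine gauss_mul_gauss_le hp ?_
    -- Here `P - S = a₂aω - a₁(v - w)`: the velocity part cancels against the shift, and only the
    -- displacement survives, with a nonnegative sign. For the velocities below, `a₃a` remains in
    -- the same way.
    have : ⟪P - S + (a₁ t * β) • (ω : E3), (a₁ t * β) • (ω : E3)⟫ = a₁ t * β * (a₂ t * a) := by
      simp only [P, S, hA.back_X t, inner_add_left, inner_sub_left, real_inner_smul_left,
        real_inner_smul_right, hω]
      linear_combination (-(a₁ t * a₁ t * β)) * hβ'
    rw [this]; positivity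
  have hV : gauss q (V 0 t x (velV v w ω)) * gauss q (V 0 t (x - a • (ω : E3)) (velW v w ω))
      ≤ gauss q P' * gauss q S' := by
    rw [eV1, eV2]
    refine gauss_mul_gauss_le hq ?_
    have : ⟪P' - S' + (-(a₂ t * β)) • (ω : E3), (-(a₂ t * β)) • (ω : E3)⟫
        = a₂ t * β * (a₃ t * a) := by
      simp only [P', S', hA.back_V t, inner_add_left, inner_sub_left, real_inner_smul_left,
        real_inner_smul_right, hω]
      linear_combination (-(a₂ t * a₂ t * β)) * hβ'
    rw [this]; positivity
  calc _ = (gauss p (X 0 t x (velV v w ω)) * gauss p (X 0 t (x - a • (ω : E3)) (velW v w ω)))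
        * (gauss q (V 0 t x (velV v w ω)) * gauss q (V 0 t (x - a • (ω : E3)) (velW v w ω))) := by
        simp only [wt]; ring
    _ ≤ (gauss p P * gauss p S) * (gauss q P' * gauss q S') :=
        mul_le_mul hX hV (mul_pos (gauss_pos _ _) (gauss_pos _ _)).le
          (mul_pos (gauss_pos _ _) (gauss_pos _ _)).le
    _ = _ := by simp only [wt]; ring

theorem max_kernelB_le (u : E3) (ω : S2) : max (kernelB u ω) 0 ≤ ‖u‖ := by
  refine max_le ?_ (norm_nonneg u)
  refine (real_inner_le_norm u (ω : E3)).trans_eq ?_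
  rw [norm_eq_of_mem_sphere, mul_one]

theorem abs_mul_mul_sub_le {φ₁ φ₂ x₁ x₂ y₁ y₂ C D R d U W : ℝ} (hφ₂ : |φ₂| ≤ C)
    (hφ : |φ₁ - φ₂| ≤ D) (hx₁ : |x₁| ≤ R * U) (hx₂ : |x₂| ≤ R * U) (hy₁ : |y₁| ≤ R * W)
    (hx : |x₁ - x₂| ≤ d * U) (hy : |y₁ - y₂| ≤ d * W) :
    |φ₁ * x₁ * y₁ - φ₂ * x₂ * y₂| ≤ (D * R ^ 2 + 2 * C * d * R) * (U * W) := by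
  have e : φ₁ * x₁ * y₁ - φ₂ * x₂ * y₂
      = (φ₁ - φ₂) * x₁ * y₁ + φ₂ * (x₁ - x₂) * y₁ + φ₂ * x₂ * (y₁ - y₂) := by ring
  have b3 : ∀ {r s t r' s' t' : ℝ}, |r| ≤ r' → |s| ≤ s' → |t| ≤ t' →
      |r * s * t| ≤ r' * s' * t' := fun {r s t r' s' t'} h1 h2 h3 => by
    rw [abs_mul, abs_mul]
    have := (abs_nonneg r).trans h1
    have := (abs_nonneg s).trans h2
    gcongr
  rw [e]
  refine (abs_add_three _ _ _).trans ?_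
  have := b3 hφ hx₁ hy₁
  have := b3 hφ₂ hx hy₁
  have := b3 hφ₂ hx₂ hy
  linarith

variable {C D R d : ℝ} {Φ₁ Φ₂ : C(ℝ≥0 × E3 × S2, ℝ)} {f₁ f₂ g₁ g₂ : C(Phase, ℝ)}

/-- On the collision domain the weights at the velocities `v'`, `w'` are exchanged for those at `v`,
`w` by `wt_velV_mul_wt_velW_le`; elsewhere the truncated kernel vanishes. -/
theorem AffineFlow.abs_gainI_sub_le (hA : AffineFlow X V a₁ a₂ a₃ b c)
    (hB : CoeffBounds a₁ a₂ a₃ α₀ τ₀) (hp : 0 < p) (hq : 0 < q) (ha : 0 ≤ a)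
    (hR : 0 ≤ R) (hd : 0 ≤ d)
    (hΦ₂ : ∀ y, |Φ₂ y| ≤ C) (hΦ : ∀ y, |Φ₁ y - Φ₂ y| ≤ D)
    (hg₁ : ∀ z, |g₁ z| ≤ R * wt p q X V z) (hg₂ : ∀ z, |g₂ z| ≤ R * wt p q X V z)
    (hg : ∀ z, |g₁ z - g₂ z| ≤ d * wt p q X V z) (z : Phase) (y : E3 × S2) :
    |gainI a Φ₁ g₁ z y - gainI a Φ₂ g₂ z y|
      ≤ (D * R ^ 2 + 2 * C * d * R) * wt p q X V z * maj p q X V (-a) z y := by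
  obtain ⟨t, x, v⟩ := z
  obtain ⟨w, ω⟩ := y
  have hC : 0 ≤ C := (abs_nonneg _).trans (hΦ₂ (t, x, ω))
  have hD : 0 ≤ D := (abs_nonneg _).trans (hΦ (t, x, ω))
  simp only [gainI, ← sub_mul, abs_mul _ (max _ _), abs_of_nonneg (le_max_right _ (0 : ℝ)), maj]
  rcases le_total 0 (kernelB (v - w) ω) with h | h
  · have h1 := abs_mul_mul_sub_le (hΦ₂ (t, x, ω)) (hΦ (t, x, ω)) (hg₁ (t, x, velV v w ω))
      (hg₂ (t, x, velV v w ω)) (hg₁ (t, x - a • (ω : E3), velW v w ω)) (hg (t, x, velV v w ω))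
      (hg (t, x - a • (ω : E3), velW v w ω))
    have h2 := hA.wt_velV_mul_wt_velW_le hB hp hq ha t x v w ω h
    calc _ ≤ (D * R ^ 2 + 2 * C * d * R)
          * (wt p q X V (t, x, v) * wt p q X V (t, x + (-a) • (ω : E3), w)) * ‖v - w‖ := by
          refine mul_le_mul (h1.trans ?_) (max_kernelB_le _ _) (le_max_right _ _) ?_
          · gcongr
          · have := (wt_pos p q X V (t, x, v)).le
            have := (wt_pos p q X V (t, x + (-a) • (ω : E3), w)).le
            positivity
      _ = _ := by ring
  · rw [max_eq_right h, mul_zero]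
    have := (wt_pos p q X V (t, x, v)).le
    have := (wt_pos p q X V (t, x + (-a) • (ω : E3), w)).le
    positivity

theorem abs_lossI_sub_le (hR : 0 ≤ R) (hd : 0 ≤ d)
    (hΦ₂ : ∀ y, |Φ₂ y| ≤ C) (hΦ : ∀ y, |Φ₁ y - Φ₂ y| ≤ D)
    (hf₁ : ∀ z, |f₁ z| ≤ R * wt p q X V z) (hf₂ : ∀ z, |f₂ z| ≤ R * wt p q X V z)
    (hf : ∀ z, |f₁ z - f₂ z| ≤ d * wt p q X V z)
    (hg₁ : ∀ z, |g₁ z| ≤ R * wt p q X V z)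
    (hg : ∀ z, |g₁ z - g₂ z| ≤ d * wt p q X V z) (z : Phase) (y : E3 × S2) :
    |lossI a Φ₁ f₁ g₁ z y - lossI a Φ₂ f₂ g₂ z y|
      ≤ (D * R ^ 2 + 2 * C * d * R) * wt p q X V z * maj p q X V a z y := by
  have hC : 0 ≤ C := (abs_nonneg _).trans (hΦ₂ (z.1, z.2.1, y.2))
  have hD : 0 ≤ D := (abs_nonneg _).trans (hΦ (z.1, z.2.1, y.2))
  simp only [lossI, ← sub_mul, abs_mul _ (max _ _), abs_of_nonneg (le_max_right _ (0 : ℝ)), maj]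
  have h1 := abs_mul_mul_sub_le (hΦ₂ (z.1, z.2.1, y.2)) (hΦ (z.1, z.2.1, y.2)) (hf₁ z) (hf₂ z)
    (hg₁ (z.1, z.2.1 + a • (y.2 : E3), y.1)) (hf z) (hg (z.1, z.2.1 + a • (y.2 : E3), y.1))
  calc _ ≤ (D * R ^ 2 + 2 * C * d * R)
        * (wt p q X V z * wt p q X V (z.1, z.2.1 + a • (y.2 : E3), y.1)) * ‖z.2.2 - y.1‖ := by
        refine mul_le_mul h1 (max_kernelB_le _ _) (le_max_right _ _) ?_
        have := (wt_pos p q X V z).le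
        have := (wt_pos p q X V (z.1, z.2.1 + a • (y.2 : E3), y.1)).le
        positivity
    _ = _ := by ring

/-- The gain term is integrable and its integral is continuous on phase space. -/
theorem AffineFlow.gainI_regular (hA : AffineFlow X V a₁ a₂ a₃ b c)
    (hB : CoeffBounds a₁ a₂ a₃ α₀ τ₀) (hp : 0 < p) (hq : 0 < q) (ha : 0 ≤ a) (hR : 0 ≤ R)
    {Φ : C(ℝ≥0 × E3 × S2, ℝ)} {g : C(Phase, ℝ)}
    (hΦ : ∀ y, |Φ y| ≤ C) (hg : ∀ z, |g z| ≤ R * wt p q X V z) :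
    (∀ z, Integrable (gainI a Φ g z) ((volume : Measure E3).prod surf)) ∧
      Continuous fun z => ∫ y, gainI a Φ g z y ∂((volume : Measure E3).prod surf) := by
  have h0 : ∀ z, 0 ≤ R * wt p q X V z := fun z => mul_nonneg hR (wt_pos _ _ _ _ _).le
  have hC : 0 ≤ C := (abs_nonneg _).trans (hΦ (0, 0, ⟨EuclideanSpace.single 0 1, by simp⟩))
  refine hA.continuous_integral_of_le_maj hB hp hq (k := -a) (C := 2 * C * R * R)
    (continuous_gainI Φ g) fun z y => ?_
  -- Comparison with the zero density, at distance `R` and with the same factor `Φ` (so `D = 0`),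
  -- turns the Lipschitz bound into a size bound.
  have h := hA.abs_gainI_sub_le hB hp hq ha hR hR (Φ₁ := Φ) (g₂ := 0) (D := 0) hΦ (by simp) hg
    (by simpa using h0) (by simpa using hg) z y
  have e : gainI a Φ 0 z y = 0 := by simp [gainI]
  rw [e, sub_zero] at h
  refine h.trans (mul_le_mul_of_nonneg_right ?_ (maj_nonneg _ _ _))
  rw [zero_mul, zero_add]
  exact mul_le_of_le_one_right (by positivity) (wt_le_one hp hq z)

/-- The loss term is integrable and its integral is continuous on phase space. -/
theorem AffineFlow.lossI_regular (hA : AffineFlow X V a₁ a₂ a₃ b c)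
    (hB : CoeffBounds a₁ a₂ a₃ α₀ τ₀) (hp : 0 < p) (hq : 0 < q) (hR : 0 ≤ R)
    {Φ : C(ℝ≥0 × E3 × S2, ℝ)} {f g : C(Phase, ℝ)}
    (hΦ : ∀ y, |Φ y| ≤ C) (hf : ∀ z, |f z| ≤ R * wt p q X V z)
    (hg : ∀ z, |g z| ≤ R * wt p q X V z) :
    (∀ z, Integrable (lossI a Φ f g z) ((volume : Measure E3).prod surf)) ∧
      Continuous fun z => ∫ y, lossI a Φ f g z y ∂((volume : Measure E3).prod surf) := by
  have h0 : ∀ z, 0 ≤ R * wt p q X V z := fun z => mul_nonneg hR (wt_pos _ _ _ _ _).le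
  have hC : 0 ≤ C := (abs_nonneg _).trans (hΦ (0, 0, ⟨EuclideanSpace.single 0 1, by simp⟩))
  refine hA.continuous_integral_of_le_maj hB hp hq (k := a) (C := 2 * C * R * R)
    (continuous_lossI Φ f g) fun z y => ?_
  have h := abs_lossI_sub_le (a := a) hR hR (Φ₁ := Φ) (f₂ := 0) (g₂ := 0) (D := 0) hΦ (by simp) hf
    (by simpa using h0) (by simpa using hf) hg (by simpa using hg) z y
  have e : lossI a Φ 0 0 z y = 0 := by simp [lossI]
  rw [e, sub_zero] at h
  refine h.trans (mul_le_mul_of_nonneg_right ?_ (maj_nonneg _ _ _))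
  rw [zero_mul, zero_add]
  exact mul_le_of_le_one_right (by positivity) (wt_le_one hp hq z)

/-- The collision operator in which the density of the collision partners and the density
lost by collisions are kept apart. -/
def coll (a : ℝ) (Fp Fm : Factor) (g f : C(Phase, ℝ)) (z : Phase) : ℝ :=
  (∫ y, gainI a (Fp g) g z y ∂((volume : Measure E3).prod surf))
    - ∫ y, lossI a (Fm g) f g z y ∂((volume : Measure E3).prod surf)

theorem measurableSet_collisionDomain (v : E3) : MeasurableSet (collisionDomain v) := by
  have : Continuous fun y : E3 × S2 => kernelB (v - y.1) y.2 := by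
    unfold kernelB; fun_prop
  exact (isClosed_le continuous_const this).measurableSet

theorem mul_max_eq_indicator (v : E3) (G : E3 × S2 → ℝ) :
    (fun y : E3 × S2 => G y * max (kernelB (v - y.1) y.2) 0)
      = (collisionDomain v).indicator fun y => G y * kernelB (v - y.1) y.2 := by
  ext1 y
  by_cases h : 0 ≤ kernelB (v - y.1) y.2
  · rw [indicator_of_mem (by exact h), max_eq_left h]
  · rw [indicator_of_notMem (by exact h), max_eq_right (le_of_not_ge h), mul_zero]

theorem gainI_eq_indicator (Fp : Factor) (f : C(Phase, ℝ)) (t : ℝ≥0) (x v : E3) :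
    gainI a (Fp f) f (t, x, v) = (collisionDomain v).indicator (gainIntegrand a Fp f t x v) :=
  mul_max_eq_indicator v _

theorem lossI_eq_indicator (Fm : Factor) (f : C(Phase, ℝ)) (t : ℝ≥0) (x v : E3) :
    lossI a (Fm f) f f (t, x, v) = (collisionDomain v).indicator (lossIntegrand a Fm f t x v) :=
  mul_max_eq_indicator v _

theorem collision_eq_coll (Fp Fm : Factor) (f : C(Phase, ℝ)) (z : Phase) :
    collision a Fp Fm f z.1 z.2.1 z.2.2 = coll a Fp Fm f f z := by
  obtain ⟨t, x, v⟩ := z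
  simp only [collision, coll, gainI_eq_indicator, lossI_eq_indicator,
    integral_indicator (measurableSet_collisionDomain v)]

theorem collisionConverges_of_integrable {Fp Fm : Factor} {f : C(Phase, ℝ)} {z : Phase}
    (h₁ : Integrable (gainI a (Fp f) f z) ((volume : Measure E3).prod surf))
    (h₂ : Integrable (lossI a (Fm f) f f z) ((volume : Measure E3).prod surf)) :
    CollisionConverges a Fp Fm f z.1 z.2.1 z.2.2 := by
  obtain ⟨t, x, v⟩ := z
  rw [gainI_eq_indicator, integrable_indicator_iff (measurableSet_collisionDomain v)] at h₁
  rw [lossI_eq_indicator, integrable_indicator_iff (measurableSet_collisionDomain v)] at h₂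
  exact ⟨h₁, h₂⟩

/-- Boundedness and Lipschitz continuity of a collision factor on the unit ball, in terms of
pointwise bounds by the weight. -/
structure FactorBounds (p q : ℝ) (X V : Curves) (C : ℝ) (F : Factor) : Prop where
  nonneg : 0 ≤ C
  bound : ∀ f : C(Phase, ℝ), (∀ z, |f z| ≤ wt p q X V z) → ∀ y, |F f y| ≤ C
  lip : ∀ f g : C(Phase, ℝ), (∀ z, |f z| ≤ wt p q X V z) → (∀ z, |g z| ≤ wt p q X V z) →
    ∀ d : ℝ, 0 ≤ d → (∀ z, |f z - g z| ≤ d * wt p q X V z) → ∀ y, |F f y - F g y| ≤ C * d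

theorem FactorBounds.mono {F : Factor} (h : FactorBounds p q X V C F) {C' : ℝ} (hC : C ≤ C') :
    FactorBounds p q X V C' F where
  nonneg := h.nonneg.trans hC
  bound f hf y := (h.bound f hf y).trans hC
  lip f g hf hg d hd hfg y :=
    (h.lip f g hf hg d hd hfg y).trans (mul_le_mul_of_nonneg_right hC hd)

/-- The final radius is at most `1`, so only `L 1` matters; boundedness follows by comparison with
`F 0`. -/
theorem IsLocallyLipschitz.exists_factorBounds {L : ℝ≥0 → ℝ≥0} {F : Factor}
    (hF : IsLocallyLipschitz p q X V L F) : ∃ C, FactorBounds p q X V C F := by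
  obtain ⟨C₀, hC₀⟩ := hF.bounded_zero
  have hlip : ∀ f g : C(Phase, ℝ), (∀ z, |f z| ≤ wt p q X V z) →
      (∀ z, |g z| ≤ wt p q X V z) → ∀ d : ℝ, 0 ≤ d →
      (∀ z, |f z - g z| ≤ d * wt p q X V z) → ∀ y, |F f y - F g y| ≤ L 1 * d := by
    intro f g hf hg d hd hfg y
    lift d to ℝ≥0 using hd
    have h := hF.lipschitz 1 f (wnorm_le_iff.2 (by simpa using hf)) g
      (wnorm_le_iff.2 (by simpa using hg)) y
    have h2 : wnorm p q X V (fun z => f z - g z) ≤ d := wnorm_le_iff.2 hfg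
    have h3 := h.trans (mul_le_mul_right h2 _)
    rw [← ENNReal.coe_mul, ← ENNReal.ofReal_coe_nnreal,
      ENNReal.ofReal_le_ofReal_iff (NNReal.coe_nonneg _), NNReal.coe_mul] at h3
    exact h3
  have hC0 : 0 ≤ C₀ := (abs_nonneg _).trans (hC₀ (0, 0, ⟨EuclideanSpace.single 0 1, by simp⟩))
  refine ⟨C₀ + L 1, by positivity, fun f hf y => ?_, fun f g hf hg d hd hfg y => ?_⟩
  · have h0 : ∀ z, |(0 : C(Phase, ℝ)) z| ≤ wt p q X V z := fun z => by
      simpa using (wt_pos p q X V z).le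
    have h1 := hlip f 0 hf h0 1 zero_le_one (by simpa using hf) y
    have h2 := hC₀ y
    calc |F f y| = |(F f y - F 0 y) + F 0 y| := by rw [sub_add_cancel]
      _ ≤ |F f y - F 0 y| + |F 0 y| := abs_add_le _ _
      _ ≤ _ := by linarith
  · refine (hlip f g hf hg d hd hfg y).trans ?_
    gcongr
    linarith

/-- The constant in the Lipschitz estimate for the collision operator on a ball of radius `R`. -/
def collConst (C R d : ℝ) : ℝ := C * d * R ^ 2 + 2 * C * d * R

variable {Fp Fm : Factor}

theorem AffineFlow.continuous_coll (hA : AffineFlow X V a₁ a₂ a₃ b c)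
    (hB : CoeffBounds a₁ a₂ a₃ α₀ τ₀) (hp : 0 < p) (hq : 0 < q) (ha : 0 ≤ a)
    (hFp : FactorBounds p q X V C Fp) (hFm : FactorBounds p q X V C Fm)
    {f g : C(Phase, ℝ)} (hf : ∀ z, |f z| ≤ wt p q X V z) (hg : ∀ z, |g z| ≤ wt p q X V z) :
    Continuous (coll a Fp Fm g f) :=
  (hA.gainI_regular hB hp hq ha zero_le_one (hFp.bound g hg) (by simpa using hg)).2.sub
    (hA.lossI_regular hB hp hq zero_le_one (hFm.bound g hg) (by simpa using hf)
      (by simpa using hg)).2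

theorem AffineFlow.abs_coll_sub_le (hA : AffineFlow X V a₁ a₂ a₃ b c)
    (hB : CoeffBounds a₁ a₂ a₃ α₀ τ₀) (hp : 0 < p) (hq : 0 < q) (ha : 0 ≤ a)
    (hFp : FactorBounds p q X V C Fp) (hFm : FactorBounds p q X V C Fm)
    (hR : 0 ≤ R) (hR1 : R ≤ 1) (hd : 0 ≤ d)
    (hf₁ : ∀ z, |f₁ z| ≤ R * wt p q X V z) (hf₂ : ∀ z, |f₂ z| ≤ R * wt p q X V z)
    (hf : ∀ z, |f₁ z - f₂ z| ≤ d * wt p q X V z)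
    (hg₁ : ∀ z, |g₁ z| ≤ R * wt p q X V z) (hg₂ : ∀ z, |g₂ z| ≤ R * wt p q X V z)
    (hg : ∀ z, |g₁ z - g₂ z| ≤ d * wt p q X V z) (z : Phase) :
    |coll a Fp Fm g₁ f₁ z - coll a Fp Fm g₂ f₂ z|
      ≤ collConst C R d * wt p q X V z * (freq p q X V (-a) z + freq p q X V a z) := by
  have up : ∀ {f : C(Phase, ℝ)}, (∀ z, |f z| ≤ R * wt p q X V z) → ∀ z, |f z| ≤ wt p q X V z :=
    fun h z => (h z).trans (mul_le_of_le_one_left (wt_pos _ _ _ _ _).le hR1)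
  have hΦp := hFp.lip g₁ g₂ (up hg₁) (up hg₂) d hd hg
  have hΦm := hFm.lip g₁ g₂ (up hg₁) (up hg₂) d hd hg
  have bound : ∀ {G₁ G₂ : E3 × S2 → ℝ} {k : ℝ},
      Integrable G₁ ((volume : Measure E3).prod surf) →
      Integrable G₂ ((volume : Measure E3).prod surf) →
      (∀ y, |G₁ y - G₂ y| ≤ collConst C R d * wt p q X V z * maj p q X V k z y) →
      |(∫ y, G₁ y ∂((volume : Measure E3).prod surf))
          - ∫ y, G₂ y ∂((volume : Measure E3).prod surf)|
        ≤ collConst C R d * wt p q X V z * freq p q X V k z := by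
    intro G₁ G₂ k h₁ h₂ h
    rw [← integral_sub h₁ h₂, freq, ← integral_const_mul, ← Real.norm_eq_abs]
    refine norm_integral_le_of_norm_le ((hA.integrable_maj hB hp hq k z).const_mul _)
      (Filter.Eventually.of_forall fun y => ?_)
    exact h y
  have b1 := bound ((hA.gainI_regular hB hp hq ha hR (hFp.bound g₁ (up hg₁)) hg₁).1 z)
    ((hA.gainI_regular hB hp hq ha hR (hFp.bound g₂ (up hg₂)) hg₂).1 z)
    (hA.abs_gainI_sub_le hB hp hq ha hR hd (hFp.bound g₂ (up hg₂)) hΦp hg₁ hg₂ hg z)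
  have b2 := bound ((hA.lossI_regular hB hp hq hR (hFm.bound g₁ (up hg₁)) hf₁ hg₁).1 z)
    ((hA.lossI_regular hB hp hq hR (hFm.bound g₂ (up hg₂)) hf₂ hg₂).1 z)
    (abs_lossI_sub_le (a := a) hR hd (hFm.bound g₂ (up hg₂)) hΦm hf₁ hf₂ hf hg₁ hg z)
  rw [coll, coll, sub_sub_sub_comm, mul_add]
  exact (abs_sub _ _).trans (add_le_add b1 b2)

/-- The time integral of the collision operator along trajectories. -/
def collInt (a : ℝ) (X V : Curves) (Fp Fm : Factor) (g f : C(Phase, ℝ)) (z : Phase) : ℝ :=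
  ∫ s in (0 : ℝ)..z.1, coll a Fp Fm g f (flow X V s.toNNReal z)

theorem AffineFlow.continuous_coll_flow (hA : AffineFlow X V a₁ a₂ a₃ b c)
    (hB : CoeffBounds a₁ a₂ a₃ α₀ τ₀) (hp : 0 < p) (hq : 0 < q) (ha : 0 ≤ a)
    (hFp : FactorBounds p q X V C Fp) (hFm : FactorBounds p q X V C Fm)
    {f g : C(Phase, ℝ)} (hf : ∀ z, |f z| ≤ wt p q X V z) (hg : ∀ z, |g z| ≤ wt p q X V z) :
    Continuous fun y : Phase × ℝ => coll a Fp Fm g f (flow X V y.2.toNNReal y.1) :=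
  (hA.continuous_coll hB hp hq ha hFp hFm hf hg).comp
    (hA.continuous_flow_comp (continuous_real_toNNReal.comp continuous_snd) continuous_fst)

theorem AffineFlow.continuous_collInt (hA : AffineFlow X V a₁ a₂ a₃ b c)
    (hB : CoeffBounds a₁ a₂ a₃ α₀ τ₀) (hp : 0 < p) (hq : 0 < q) (ha : 0 ≤ a)
    (hFp : FactorBounds p q X V C Fp) (hFm : FactorBounds p q X V C Fm)
    {f g : C(Phase, ℝ)} (hf : ∀ z, |f z| ≤ wt p q X V z) (hg : ∀ z, |g z| ≤ wt p q X V z) :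
    Continuous (collInt a X V Fp Fm g f) :=
  intervalIntegral.continuous_parametric_intervalIntegral_of_continuous
    (f := fun z (s : ℝ) => coll a Fp Fm g f (flow X V s.toNNReal z))
    (hA.continuous_coll_flow hB hp hq ha hFp hFm hf hg)
    (NNReal.continuous_coe.comp continuous_fst)

/-- The weight is constant along trajectories and leaves the time integral, where only the collision
frequencies remain. `K` does not depend on `R`, so a small ball makes the operator contract. -/
theorem AffineFlow.exists_abs_collInt_sub_le (hA : AffineFlow X V a₁ a₂ a₃ b c)
    (hB : CoeffBounds a₁ a₂ a₃ α₀ τ₀) (hp : 0 < p) (hq : 0 < q) (ha : 0 ≤ a)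
    (hFp : FactorBounds p q X V C Fp) (hFm : FactorBounds p q X V C Fm) :
    ∃ K : ℝ, 0 ≤ K ∧ ∀ (R d : ℝ), 0 ≤ R → R ≤ 1 → 0 ≤ d → ∀ f₁ f₂ g₁ g₂ : C(Phase, ℝ),
      (∀ z, |f₁ z| ≤ R * wt p q X V z) → (∀ z, |f₂ z| ≤ R * wt p q X V z) →
      (∀ z, |f₁ z - f₂ z| ≤ d * wt p q X V z) →
      (∀ z, |g₁ z| ≤ R * wt p q X V z) → (∀ z, |g₂ z| ≤ R * wt p q X V z) →
      (∀ z, |g₁ z - g₂ z| ≤ d * wt p q X V z) → ∀ z,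
      |collInt a X V Fp Fm g₁ f₁ z - collInt a X V Fp Fm g₂ f₂ z| ≤ K * R * d * wt p q X V z := by
  obtain ⟨K₁, hK₁, h₁⟩ := hA.exists_integral_freq_le hB hp hq (-a)
  obtain ⟨K₂, hK₂, h₂⟩ := hA.exists_integral_freq_le hB hp hq a
  have hC := hFp.nonneg
  refine ⟨3 * C * (K₁ + K₂), by positivity, ?_⟩
  intro R d hR hR1 hd f₁ f₂ g₁ g₂ hf₁ hf₂ hf hg₁ hg₂ hg z
  have up : ∀ {f : C(Phase, ℝ)}, (∀ z, |f z| ≤ R * wt p q X V z) → ∀ z, |f z| ≤ wt p q X V z :=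
    fun h z => (h z).trans (mul_le_of_le_one_left (wt_pos _ _ _ _ _).le hR1)
  have hw := (wt_pos p q X V z).le
  have hfl : Continuous fun s : ℝ => flow X V s.toNNReal z :=
    hA.continuous_flow_comp continuous_real_toNNReal continuous_const
  have i1 := ((hA.continuous_coll hB hp hq ha hFp hFm (up hf₁) (up hg₁)).comp
    hfl).intervalIntegrable (μ := volume) 0 z.1
  have i2 := ((hA.continuous_coll hB hp hq ha hFp hFm (up hf₂) (up hg₂)).comp
    hfl).intervalIntegrable (μ := volume) 0 z.1
  have j1 := ((hA.continuous_freq hB hp hq (-a)).comp hfl).intervalIntegrable (μ := volume) 0 z.1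
  have j2 := ((hA.continuous_freq hB hp hq a).comp hfl).intervalIntegrable (μ := volume) 0 z.1
  simp only [Function.comp_def] at i1 i2 j1 j2
  have hcc : collConst C R d ≤ 3 * C * R * d := by
    have : C * d * R ^ 2 ≤ C * d * R := by
      rw [sq]
      exact mul_le_mul_of_nonneg_left (mul_le_of_le_one_right hR hR1) (by positivity)
    rw [collConst]; linarith
  have hcc0 : 0 ≤ collConst C R d := by rw [collConst]; positivity
  rw [collInt, collInt, ← intervalIntegral.integral_sub i1 i2]
  calc |∫ s in (0 : ℝ)..z.1, (coll a Fp Fm g₁ f₁ (flow X V s.toNNReal z)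
          - coll a Fp Fm g₂ f₂ (flow X V s.toNNReal z))|
      ≤ ∫ s in (0 : ℝ)..z.1, collConst C R d * wt p q X V z
          * (freq p q X V (-a) (flow X V s.toNNReal z)
            + freq p q X V a (flow X V s.toNNReal z)) := by
        rw [← Real.norm_eq_abs]
        refine intervalIntegral.norm_integral_le_of_norm_le z.1.coe_nonneg
          (Filter.Eventually.of_forall fun s _ => ?_) ((j1.add j2).const_mul _)
        have := hA.abs_coll_sub_le hB hp hq ha hFp hFm hR hR1 hd hf₁ hf₂ hf hg₁ hg₂ hg
          (flow X V s.toNNReal z)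
        rwa [hA.wt_flow] at this
    _ = collConst C R d * wt p q X V z
          * ((∫ s in (0 : ℝ)..z.1, freq p q X V (-a) (flow X V s.toNNReal z))
            + ∫ s in (0 : ℝ)..z.1, freq p q X V a (flow X V s.toNNReal z)) := by
        rw [intervalIntegral.integral_const_mul, intervalIntegral.integral_add j1 j2]
    _ ≤ 3 * C * R * d * wt p q X V z * (K₁ + K₂) := by
        have k1 := h₁ z z.1
        have k2 := h₂ z z.1
        exact mul_le_mul (mul_le_mul_of_nonneg_right hcc hw) (add_le_add k1 k2)
          (add_nonneg
            (intervalIntegral.integral_nonneg z.1.coe_nonneg fun _ _ => freq_nonneg _ _)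
            (intervalIntegral.integral_nonneg z.1.coe_nonneg fun _ _ => freq_nonneg _ _))
          (by positivity)
    _ = _ := by ring

end Collision

/-! ### Fixed points in a weighted space and a positivity lemma -/

/-- Contraction principle for continuous functions dominated by a positive weight. -/
theorem exists_fixedPoint_of_weighted_contraction {α : Type*} [TopologicalSpace α] {w : α → ℝ}
    (hw : Continuous w) (hpos : ∀ z, 0 < w z) {R : ℝ} (hR : 0 ≤ R) (T : C(α, ℝ) → α → ℝ)
    (hTc : ∀ f, (∀ z, |f z| ≤ R * w z) → Continuous (T f))
    (hT : ∀ f, (∀ z, |f z| ≤ R * w z) → ∀ z, |T f z| ≤ R * w z)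
    (hcontr : ∀ f g, (∀ z, |f z| ≤ R * w z) → (∀ z, |g z| ≤ R * w z) → ∀ d, 0 ≤ d →
      (∀ z, |f z - g z| ≤ d * w z) → ∀ z, |T f z - T g z| ≤ d / 2 * w z) :
    ∃ f : C(α, ℝ), (∀ z, |f z| ≤ R * w z) ∧ ∀ z, f z = T f z := by
  let B := Metric.closedBall (0 : BoundedContinuousFunction α ℝ) R
  have hBz : ∀ u : B, ∀ z, |u.1 z| ≤ R := fun u z =>
    (u.1.norm_coe_le_norm z).trans (mem_closedBall_zero_iff.1 u.2)
  -- Multiplication by `w` carries the closed ball of bounded continuous functions, which is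
  -- complete, onto the weighted ball.
  let toF : B → C(α, ℝ) := fun u => ⟨fun z => u.1 z * w z, u.1.continuous.mul hw⟩
  have htoF : ∀ u z, |toF u z| ≤ R * w z := fun u z => by
    change |u.1 z * w z| ≤ _
    rw [abs_mul, abs_of_pos (hpos z)]
    exact mul_le_mul_of_nonneg_right (hBz u z) (hpos z).le
  have hbd : ∀ u z, ‖T (toF u) z / w z‖ ≤ R := fun u z => by
    rw [norm_div, Real.norm_of_nonneg (hpos z).le, div_le_iff₀ (hpos z)]
    exact hT _ (htoF u) z
  let S : B → B := fun u =>
    ⟨BoundedContinuousFunction.ofNormedAddCommGroup (fun z => T (toF u) z / w z)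
      ((hTc _ (htoF u)).div hw fun z => (hpos z).ne') R (hbd u),
      mem_closedBall_zero_iff.2 (BoundedContinuousFunction.norm_ofNormedAddCommGroup_le _ hR _)⟩
  have hS : ContractingWith (1 / 2) S := by
    refine ⟨by norm_num, LipschitzWith.of_dist_le_mul fun u v => ?_⟩
    have hd : ∀ z, |toF u z - toF v z| ≤ dist u v * w z := fun z => by
      change |u.1 z * w z - v.1 z * w z| ≤ _
      rw [← sub_mul, abs_mul, abs_of_pos (hpos z)]
      rw [← Real.dist_eq]
      exact mul_le_mul_of_nonneg_right
        (BoundedContinuousFunction.dist_coe_le_dist (f := u.1) (g := v.1) z) (hpos z).le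
    have hd' := hcontr _ _ (htoF u) (htoF v) _ dist_nonneg hd
    refine (BoundedContinuousFunction.dist_le (by positivity)).2 fun z => ?_
    change |T (toF u) z / w z - T (toF v) z / w z| ≤ _
    rw [← sub_div, abs_div, abs_of_pos (hpos z), div_le_iff₀ (hpos z)]
    refine (hd' z).trans_eq ?_
    push_cast
    ring
  have : Nonempty B := ⟨⟨0, by simpa [B] using hR⟩⟩
  have : CompleteSpace B := Metric.isClosed_closedBall.completeSpace_coe
  have hfix := hS.fixedPoint_isFixedPt
  set u := ContractingWith.fixedPoint S hS
  refine ⟨toF u, htoF u, fun z => ?_⟩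
  have h1 : T (toF u) z / w z = u.1 z :=
    congrArg (fun v : B => v.1 z) hfix
  change u.1 z * w z = _
  rw [← h1, div_mul_cancel₀ _ (hpos z).ne']

/-- Positivity for scalar linear equations with nonnegative source. -/
theorem nonneg_of_hasDerivAt_linear {Y G ν : ℝ → ℝ} (hν : Continuous ν) (hG : ∀ s, 0 ≤ G s)
    (hY : ∀ s, 0 ≤ s → HasDerivAt Y (G s - Y s * ν s) s) (h0 : 0 ≤ Y 0) {t : ℝ} (ht : 0 ≤ t) :
    0 ≤ Y t := by
  -- Integrating factor `exp N`; no sign of `ν` is needed, which matters because `F⁻` may be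
  -- negative.
  set N : ℝ → ℝ := fun s => ∫ r in (0 : ℝ)..s, ν r
  have hN : ∀ s, HasDerivAt N (ν s) s := fun s => hν.integral_hasStrictDerivAt 0 s |>.hasDerivAt
  have hd : ∀ s, 0 ≤ s → HasDerivAt (fun s => Y s * Real.exp (N s)) (G s * Real.exp (N s)) s :=
    fun s hs => ((hY s hs).fun_mul (hN s).exp).congr_deriv (by ring)
  have hm : MonotoneOn (fun s => Y s * Real.exp (N s)) (Ici 0) := by
    refine monotoneOn_of_deriv_nonneg (convex_Ici 0)
      (fun s hs => (hd s hs).continuousAt.continuousWithinAt)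
      (fun s hs => (hd s (interior_subset hs)).differentiableAt.differentiableWithinAt)
      fun s hs => ?_
    rw [(hd s (interior_subset hs)).deriv]
    exact mul_nonneg (hG s) (Real.exp_pos _).le
  have h := hm self_mem_Ici (show t ∈ Ici (0 : ℝ) from ht) ht
  exact nonneg_of_mul_nonneg_left ((mul_nonneg h0 (Real.exp_pos _).le).trans h) (Real.exp_pos _)

/-! ### Positivity, and mild solutions as fixed points -/

section Mild

variable {p q : ℝ} {X V : Curves} {a₁ a₂ a₃ : ℝ≥0 → ℝ} {b c : ℝ≥0 → E3} {α₀ τ₀ : ℝ}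
variable {a C R : ℝ} {Fp Fm : Factor}

/-- The initial datum transported along the flow. -/
def transport (X V : Curves) (f₀ : C(E3 × E3, ℝ)) (z : Phase) : ℝ :=
  f₀ (X 0 z.1 z.2.1 z.2.2, V 0 z.1 z.2.1 z.2.2)

theorem AffineFlow.continuous_transport (hA : AffineFlow X V a₁ a₂ a₃ b c)
    (f₀ : C(E3 × E3, ℝ)) : Continuous (transport X V f₀) :=
  f₀.continuous.comp (hA.continuous_back_X.prodMk hA.continuous_back_V)

theorem AffineFlow.transport_flow (hA : AffineFlow X V a₁ a₂ a₃ b c) (f₀ : C(E3 × E3, ℝ))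
    (s : ℝ≥0) (z : Phase) : transport X V f₀ (flow X V s z) = transport X V f₀ z := by
  simp only [transport, flow, hA.invariant_X, hA.invariant_V]

theorem AffineFlow.continuous_collisionFreq (hA : AffineFlow X V a₁ a₂ a₃ b c)
    (hB : CoeffBounds a₁ a₂ a₃ α₀ τ₀) (hp : 0 < p) (hq : 0 < q)
    {Φ : C(ℝ≥0 × E3 × S2, ℝ)} {g : C(Phase, ℝ)}
    (hΦ : ∀ y, |Φ y| ≤ C) (hg : ∀ z, |g z| ≤ wt p q X V z) :
    Continuous fun z => ∫ y, lossI a Φ 1 g z y ∂((volume : Measure E3).prod surf) := by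
  have hC : 0 ≤ C := (abs_nonneg _).trans (hΦ (0, 0, ⟨EuclideanSpace.single 0 1, by simp⟩))
  refine (hA.continuous_integral_of_le_maj hB hp hq (k := a) (C := C)
    (continuous_lossI Φ 1 g) fun z y => ?_).2
  rw [lossI, ContinuousMap.one_apply, mul_one, abs_mul, abs_mul,
    abs_of_nonneg (le_max_right _ (0 : ℝ)), maj, ← mul_assoc]
  have := (wt_pos p q X V (z.1, z.2.1 + a • (y.2 : E3), y.1)).le
  exact mul_le_mul (mul_le_mul (hΦ _) (hg _) (abs_nonneg _) hC) (max_kernelB_le _ _)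
    (le_max_right _ _) (by positivity)

/-- With the partner density `g` fixed, the operator is affine in `f`, so along a trajectory the
equation reads `Y' = G - νY`. -/
theorem coll_eq_gain_sub_mul (g f : C(Phase, ℝ)) (z : Phase) :
    coll a Fp Fm g f z = (∫ y, gainI a (Fp g) g z y ∂((volume : Measure E3).prod surf))
      - f z * ∫ y, lossI a (Fm g) 1 g z y ∂((volume : Measure E3).prod surf) := by
  rw [coll, ← integral_const_mul]
  congr 2
  ext1 y
  simp only [lossI, ContinuousMap.one_apply]
  ring

/-- Solutions of the equation with a nonnegative density of collision partners are
nonnegative. -/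
theorem AffineFlow.nonneg_of_eq_transport_add_collInt (hA : AffineFlow X V a₁ a₂ a₃ b c)
    (hB : CoeffBounds a₁ a₂ a₃ α₀ τ₀) (hp : 0 < p) (hq : 0 < q) (ha : 0 ≤ a)
    (hFp : FactorBounds p q X V C Fp) (hFm : FactorBounds p q X V C Fm)
    {f₀ : C(E3 × E3, ℝ)} (hf₀ : ∀ y, 0 ≤ f₀ y) {f g : C(Phase, ℝ)}
    (hf : ∀ z, |f z| ≤ wt p q X V z) (hg : ∀ z, |g z| ≤ wt p q X V z) (hg0 : ∀ z, 0 ≤ g z)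
    (hFg : ∀ y, 0 ≤ Fp g y)
    (heq : ∀ z, f z = transport X V f₀ z + collInt a X V Fp Fm g f z) (z : Phase) : 0 ≤ f z := by
  have hfl : Continuous fun s : ℝ => flow X V s.toNNReal z :=
    hA.continuous_flow_comp continuous_real_toNNReal continuous_const
  have hcc := (hA.continuous_coll hB hp hq ha hFp hFm hf hg).comp hfl
  set Y : ℝ → ℝ := fun t => transport X V f₀ z
    + ∫ s in (0 : ℝ)..t, coll a Fp Fm g f (flow X V s.toNNReal z) with hYdef
  have hYf : ∀ s : ℝ≥0, Y s = f (flow X V s z) := fun s => by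
    rw [heq, hA.transport_flow, collInt]
    simp only [hA.flow_flow]
    rfl
  have hY0 : 0 ≤ Y 0 := by
    simp only [hYdef, intervalIntegral.integral_same, add_zero]
    exact hf₀ _
  have hν := (hA.continuous_collisionFreq (a := a) hB hp hq (hFm.bound g hg) hg).comp hfl
  have h := nonneg_of_hasDerivAt_linear (Y := Y) hν
    (G := fun s => ∫ y, gainI a (Fp g) g (flow X V s.toNNReal z) y
      ∂((volume : Measure E3).prod surf))
    (fun s => integral_nonneg fun y => mul_nonneg (mul_nonneg (mul_nonneg (hFg _) (hg0 _))
      (hg0 _)) (le_max_right _ _)) (fun s hs => ?_) hY0 z.1.coe_nonneg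
  · rwa [hYf, hA.flow_self] at h
  · have h1 := (hcc.integral_hasStrictDerivAt 0 s).hasDerivAt.const_add (transport X V f₀ z)
    refine h1.congr_deriv ?_
    lift s to ℝ≥0 using hs
    simp only [Function.comp_def, coll_eq_gain_sub_mul, hYf, Real.toNNReal_coe]

theorem AffineFlow.isMildSolution_of_eq (hA : AffineFlow X V a₁ a₂ a₃ b c)
    (hB : CoeffBounds a₁ a₂ a₃ α₀ τ₀) (hp : 0 < p) (hq : 0 < q) (ha : 0 ≤ a)
    (hFp : FactorBounds p q X V C Fp) (hFm : FactorBounds p q X V C Fm)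
    {f₀ : C(E3 × E3, ℝ)} {f : C(Phase, ℝ)} (hf : ∀ z, |f z| ≤ wt p q X V z)
    (heq : ∀ z, f z = transport X V f₀ z + collInt a X V Fp Fm f f z) :
    IsMildSolution a X V Fp Fm f₀ f where
  initial x v := by
    rw [heq]
    simp [transport, collInt, hA.init_X, hA.init_V]
  mild := Filter.Eventually.of_forall fun y _ => by
    have hfl : Continuous fun s : ℝ => flow X V s.toNNReal (y.1.toNNReal, y.2.1, y.2.2) :=
      hA.continuous_flow_comp continuous_real_toNNReal continuous_const
    have hcoll : ∀ s : ℝ, collision a Fp Fm f s.toNNReal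
          (X s.toNNReal y.1.toNNReal y.2.1 y.2.2) (V s.toNNReal y.1.toNNReal y.2.1 y.2.2)
        = coll a Fp Fm f f (flow X V s.toNNReal (y.1.toNNReal, y.2.1, y.2.2)) := fun s =>
      collision_eq_coll Fp Fm f (flow X V s.toNNReal (y.1.toNNReal, y.2.1, y.2.2))
    refine ⟨Filter.Eventually.of_forall fun s _ => ?_, ?_, ?_⟩
    · exact collisionConverges_of_integrable
        (z := flow X V s.toNNReal (y.1.toNNReal, y.2.1, y.2.2))
        ((hA.gainI_regular hB hp hq ha zero_le_one (hFp.bound f hf) (by simpa using hf)).1 _)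
        ((hA.lossI_regular hB hp hq zero_le_one (hFm.bound f hf) (by simpa using hf)
          (by simpa using hf)).1 _)
    · simp only [hcoll]
      exact ((hA.continuous_coll hB hp hq ha hFp hFm hf hf).comp hfl).intervalIntegrable _ _
    · simp only [hcoll]
      exact heq (y.1.toNNReal, y.2.1, y.2.2)

/-- By continuity a mild solution satisfies the integral equation at every point. -/
theorem AffineFlow.eq_of_isMildSolution (hA : AffineFlow X V a₁ a₂ a₃ b c)
    (hB : CoeffBounds a₁ a₂ a₃ α₀ τ₀) (hp : 0 < p) (hq : 0 < q) (ha : 0 ≤ a)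
    (hFp : FactorBounds p q X V C Fp) (hFm : FactorBounds p q X V C Fm)
    {f₀ : C(E3 × E3, ℝ)} {f : C(Phase, ℝ)} (hf : ∀ z, |f z| ≤ wt p q X V z)
    (hmild : IsMildSolution a X V Fp Fm f₀ f) (z : Phase) :
    f z = transport X V f₀ z + collInt a X V Fp Fm f f z := by
  obtain ⟨t, x, v⟩ := z
  rcases eq_or_ne t 0 with rfl | ht
  · rw [hmild.initial]
    simp [transport, collInt, hA.init_X, hA.init_V]
  have hφ : Continuous fun y : ℝ × E3 × E3 => ((y.1.toNNReal, y.2.1, y.2.2) : Phase) :=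
    (continuous_real_toNNReal.comp continuous_fst).prodMk continuous_snd
  -- The equation is known almost everywhere for `t ≥ 0` only. Two continuous functions agreeing
  -- almost everywhere on the open set `t > 0` agree there everywhere; `t = 0` is covered by the
  -- initial condition.
  have hU : IsOpen {y : ℝ × E3 × E3 | 0 < y.1} := isOpen_lt continuous_const continuous_fst
  have hc := (hA.continuous_transport f₀).add (hA.continuous_collInt hB hp hq ha hFp hFm hf hf)
  have hopen : (volume : Measure (ℝ × E3 × E3)).IsOpenPosMeasure :=
    Measure.prod.instIsOpenPosMeasure
  have key := Measure.eqOn_open_of_ae_eq (μ := (volume : Measure (ℝ × E3 × E3)))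
    (f := fun y => f (y.1.toNNReal, y.2.1, y.2.2))
    (g := fun y => transport X V f₀ (y.1.toNNReal, y.2.1, y.2.2)
      + collInt a X V Fp Fm f f (y.1.toNNReal, y.2.1, y.2.2)) ?_ hU
    (f.continuous.comp hφ).continuousOn (hc.comp hφ).continuousOn
  · have := key (show ((t : ℝ), x, v) ∈ {y : ℝ × E3 × E3 | 0 < y.1} from
      NNReal.coe_pos.2 (pos_iff_ne_zero.2 ht))
    simpa only [Real.toNNReal_coe] using this
  · refine (ae_restrict_iff' hU.measurableSet).2 (hmild.mild.mono fun y hy hy0 => ?_)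
    have h := (hy (le_of_lt hy0)).equation
    refine h.trans (congrArg (transport X V f₀ (y.1.toNNReal, y.2.1, y.2.2) + ·) ?_)
    refine intervalIntegral.integral_congr fun s _ => ?_
    exact collision_eq_coll Fp Fm f (flow X V s.toNNReal (y.1.toNNReal, y.2.1, y.2.2))

end Mild

end Enskog

end

/-! ### Existence, positivity and uniqueness -/

open Enskog in
theorem mainTheorem1
    (a p q : ℝ) (ha : 0 < a) (hp : 0 < p) (hq : 0 < q)
    (E : ℝ≥0 → Enskog.E3 → Enskog.E3) (X V : Enskog.Curves)
    (hXV : Enskog.IsBicharacteristic E X V)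
    (α₁ α₂ α₃ : Enskog.Coeff) (α₀ τ₀ : ℝ)
    (hforce : Enskog.ForceConditions X V α₁ α₂ α₃ α₀ τ₀)
    (L : ℝ≥0 → ℝ≥0) (hLpos : ∀ R, 0 < L R) (hLmono : Monotone L)
    (Fp Fm : Enskog.Factor)
    (hFp : Enskog.IsLocallyLipschitz p q X V L Fp)
    (hFm : Enskog.IsLocallyLipschitz p q X V L Fm)
    (hFp_nonneg : ∀ R : ℝ≥0, ∀ f ∈ Enskog.ball p q X V R, (∀ z, 0 ≤ f z) → ∀ y, 0 ≤ Fp f y) :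
    ∃ R₀ : ℝ≥0, 0 < R₀ ∧ ∃ δ : ℝ≥0, 0 < δ ∧
      ∀ f₀ : C(Enskog.E3 × Enskog.E3, ℝ), (∀ y, 0 ≤ f₀ y) →
        Enskog.wnorm p q X V
          (fun z => f₀ (X 0 z.1 z.2.1 z.2.2, V 0 z.1 z.2.1 z.2.2)) ≤ δ →
        ∃ f ∈ Enskog.ball p q X V R₀, (∀ z, 0 ≤ f z) ∧
          Enskog.IsMildSolution a X V Fp Fm f₀ f ∧
          ∀ g ∈ Enskog.ball p q X V R₀,
            Enskog.IsMildSolution a X V Fp Fm f₀ g → g = f := by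
  have hA := hforce.affineFlow hXV
  have hB := hforce.coeffBounds hXV
  obtain ⟨C₁, hC₁⟩ := hFp.exists_factorBounds
  obtain ⟨C₂, hC₂⟩ := hFm.exists_factorBounds
  have hCp := hC₁.mono (le_max_left C₁ C₂)
  have hCm := hC₂.mono (le_max_right C₁ C₂)
  obtain ⟨K, hK, hest⟩ := hA.exists_abs_collInt_sub_le hB hp hq ha.le hCp hCm
  have hw0 : ∀ z, 0 < wt p q X V z := wt_pos p q X V
  -- Chosen so that `K * R ≤ 1/2` and `R ≤ 1`. With `δ = R/2`, the datum and the collision term each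
  -- contribute at most half of the radius.
  set R : ℝ≥0 := ⟨1 / (2 * (K + 1)), by positivity⟩ with hRdef
  have hR0 : (0 : ℝ) < R := by change 0 < 1 / (2 * (K + 1)); positivity
  have hKR : K * R ≤ 1 / 2 := by
    change K * (1 / (2 * (K + 1))) ≤ 1 / 2
    rw [mul_one_div, div_le_div_iff₀ (by positivity) (by norm_num)]
    linarith
  have hR1 : (R : ℝ) ≤ 1 := by
    change 1 / (2 * (K + 1)) ≤ 1
    rw [div_le_one (by positivity)]
    linarith
  have up : ∀ {f : C(Phase, ℝ)}, (∀ z, |f z| ≤ R * wt p q X V z) → ∀ z, |f z| ≤ wt p q X V z :=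
    fun h z => (h z).trans (mul_le_of_le_one_left (hw0 z).le hR1)
  have hKd : ∀ {d : ℝ}, 0 ≤ d → ∀ z, K * R * d * wt p q X V z ≤ d / 2 * wt p q X V z :=
    fun {d} hd z => mul_le_mul_of_nonneg_right (by nlinarith) (hw0 z).le
  have habs : ∀ {f : C(Phase, ℝ)} {k : ℝ}, (∀ z, |f z| ≤ k * wt p q X V z) →
      ∀ z, |(|f| : C(Phase, ℝ)) z| ≤ k * wt p q X V z := fun h z => by
    simpa using h z
  refine ⟨R, hR0, R / 2, half_pos hR0, fun f₀ hf₀ hδ => ?_⟩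
  have hδ' : ∀ z, |transport X V f₀ z| ≤ R / 2 * wt p q X V z := by
    simpa [transport] using wnorm_le_iff.1 hδ
  -- Evaluating partners and factors at `|f|` makes the gain nonnegative before anything is known
  -- about the sign of `f`, and keeps the Lipschitz bounds since `||f| - |g|| ≤ |f - g|`.
  obtain ⟨f, hfR, hfix⟩ := exists_fixedPoint_of_weighted_contraction
    (hA.continuous_wt (p := p) (q := q)) hw0 hR0.le
    (fun f z => transport X V f₀ z + collInt a X V Fp Fm |f| f z)
    (fun f hf => (hA.continuous_transport f₀).add
      (hA.continuous_collInt hB hp hq ha.le hCp hCm (up hf) (up (habs hf))))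
    (fun f hf z => by
      have h0 : ∀ z, |(0 : C(Phase, ℝ)) z| ≤ R * wt p q X V z := fun z => by
        simpa using mul_nonneg hR0.le (hw0 z).le
      have h1 := (hest R R hR0.le hR1 hR0.le f 0 |f| 0 hf h0 (by simpa using hf) (habs hf) h0
        (by simpa using hf) z).trans (hKd hR0.le z)
      have h2 : collInt a X V Fp Fm 0 0 z = 0 := by
        simp [collInt, coll, gainI, lossI]
      rw [h2, sub_zero] at h1
      refine (abs_add_le _ _).trans ((add_le_add (hδ' z) h1).trans_eq ?_)
      ring)
    (fun f g hf hg d hd hfg z => by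
      rw [add_sub_add_left_eq_sub]
      refine (hest R d hR0.le hR1 hd f g |f| |g| hf hg hfg (habs hf) (habs hg)
        (fun z => ?_) z).trans (hKd hd z)
      simpa using (abs_abs_sub_abs_le_abs_sub (f z) (g z)).trans (hfg z))
  have hRball : ∀ {g : C(Phase, ℝ)}, (∀ z, |g z| ≤ R * wt p q X V z) → g ∈ ball p q X V R :=
    fun h => wnorm_le_iff.2 h
  have hf0 := hA.nonneg_of_eq_transport_add_collInt hB hp hq ha.le hCp hCm hf₀ (up hfR)
    (up (habs hfR)) (fun z => by simp)
    (hFp_nonneg R _ (hRball (habs hfR)) fun z => by simp) hfix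
  have hfabs : |f| = f := by
    ext z
    simpa using hf0 z
  rw [hfabs] at hfix
  refine ⟨f, hRball hfR, hf0, hA.isMildSolution_of_eq hB hp hq ha.le hCp hCm (up hfR) hfix,
    fun g hg hgm => ?_⟩
  have hgR : ∀ z, |g z| ≤ R * wt p q X V z := wnorm_le_iff.1 hg
  have hgfix := hA.eq_of_isMildSolution hB hp hq ha.le hCp hCm (up hgR) hgm
  -- Uniqueness in the contraction principle concerns the modified equation, and `g` need not be
  -- nonnegative. The estimate is therefore iterated on the original equation, starting from `|g -
  -- f| ≤ 2R` times the weight.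
  have hiter : ∀ n : ℕ, ∀ z, |g z - f z| ≤ (2 * R) * (1 / 2) ^ n * wt p q X V z := by
    intro n
    induction n with
    | zero =>
      intro z
      refine (abs_sub _ _).trans ((add_le_add (hgR z) (hfR z)).trans_eq ?_)
      ring
    | succ n ih =>
      intro z
      have h := (hest R _ hR0.le hR1 (by positivity) g f g f hgR hfR ih hgR hfR ih z).trans
        (hKd (by positivity) z)
      rw [hgfix, hfix, add_sub_add_left_eq_sub]
      refine h.trans_eq ?_
      rw [pow_succ]; ring
  ext z
  have hlim : Filter.Tendsto (fun n : ℕ => (2 * R) * (1 / 2 : ℝ) ^ n * wt p q X V z) Filter.atTop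
      (nhds 0) := by
    have := ((tendsto_pow_atTop_nhds_zero_of_lt_one (r := (1 / 2 : ℝ)) (by norm_num)
      (by norm_num)).const_mul (2 * (R : ℝ))).mul_const (wt p q X V z)
    simpa using this
  have h0 : |g z - f z| ≤ 0 := ge_of_tendsto' hlim fun n => hiter n z
  exact sub_eq_zero.1 (abs_nonpos_iff.1 h0)
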